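/- Let $\mathbb{K}$ be an algebraically closed field of characteristic zero, and let $\mathcal{A}=\mathbb{K}[X_1,\dots,X_6]$ be the Poisson algebra (the semiclassical limit of $U_q^+(G_2)$) with the Poisson bracket determined by $$\begin{aligned} \{X_2,X_1\}&=-3X_1X_2,& \{X_3,X_1\}&=-X_1X_3-X_2,& \{X_3,X_2\}&=-3X_2X_3,\\ \{X_4,X_1\}&=-2X_3^2,& \{X_4,X_2\}&=-3X_2X_4-4X_3^3,& \{X_4,X_3\}&=-3X_3X_4,\\ \{X_5,X_1\}&=X_1X_5-2X_3,& \{X_5,X_2\}&=-6X_3^2,& \{X_5,X_3\}&=-X_3X_5-3X_4,\\ \{X_5,X_4\}&=-3X_4X_5,& \{X_6,X_1\}&=3X_1X_6-3X_5,& \{X_6,X_2\}&=3X_2X_6+9X_4-18X_3X_5,\\ \{X_6,X_3\}&=-6X_5^2,& \{X_6,X_4\}&=-3X_4X_6-4X_5^3,& \{X_6,X_5\}&=-3X_5X_6 . \end{aligned}$$ Put $$\Omega_1=X_1X_3X_5-\tfrac32X_1X_4-\tfrac12X_2X_5+\tfrac12X_3^2,$$ $$\Omega_2=X_2X_4X_6-\tfrac23X_3^3X_6-\tfrac23X_2X_5^3+2X_3^2X_5^2-3X_3X_4X_5+\tfrac32X_4^2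 .$$ A Poisson ideal is an ideal $I$ with $\{\mathcal{A},I\}\subseteq I$; a Poisson prime ideal is a proper Poisson ideal $P$ such that, for all Poisson ideals $I_1,I_2$ with $I_1I_2\subseteq P$, one has $I_1\subseteq P$ or $I_2\subseteq P$. Let the torus $\mathcal{H}=(\mathbb{K}^*)^2$ act on $\mathcal{A}$ by the $\mathbb{K}$-algebra automorphisms for which $(\alpha_1,\alpha_6)$ multiplies $X_1,\dots,X_6$ by $\alpha_1,\ \alpha_1^3\alpha_6,\ \alpha_1^2\alpha_6,\ \alpha_1^3\alpha_6^2,\ \alpha_1\alpha_6,\ \alpha_6$ respectively. For an ideal $J$ of $\mathcal{A}$, the $J$-stratum $\mathrm{P.Spec}_J(\mathcal{A})$ is the set of all Poisson prime ideals $P$ of $\mathcal{A}$ with $\bigcap_{h\in\mathcal{H}}h\cdot P=J$. Writing $\langle\cdots\rangle$ for the ideal of $\mathcal{A}$ generated by the listed elements, one has: 1. $\mathrm{P.Spec}_{\langle\Omega_1\rangle}(\mathcal{A})=\{\langle\Omega_1\rangle\}\cup\{\langle\Omega_1,\Omega_2-\beta\rangle\mid\beta\in\mathbb{K}^*\}$;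 2. $\mathrm{P.Spec}_{\langle\Omega_2\rangle}(\mathcal{A})=\{\langle\Omega_2\rangle\}\cup\{\langle\Omega_1-\alpha,\Omega_2\rangle\mid\alpha\in\mathbb{K}^*\}$. -/

import Mathlib

open MvPolynomial

/-- A Poisson bracket on a commutative `K`-algebra `A`: a skew-symmetric `K`-bilinear map satisfying
the Leibniz rule and the Jacobi identity. -/
structure PoissonBracket (K A : Type*) [CommRing K] [CommRing A] [Algebra K A] where
  bracket : A →ₗ[K] A →ₗ[K] A
  skew : ∀ x y, bracket x y = -bracket y x
  leibniz : ∀ x y z, bracket x (y * z) = bracket x y * z + y * bracket x z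
  jacobi : ∀ x y z,
    bracket x (bracket y z) + bracket y (bracket z x) + bracket z (bracket x y) = 0

namespace PoissonBracket

variable {K A : Type*} [CommRing K] [CommRing A] [Algebra K A]

/-- An ideal `I` is a Poisson ideal if `{A, I} ⊆ I`. -/
def IsPoissonIdeal (B : PoissonBracket K A) (I : Ideal A) : Prop :=
  ∀ a : A, ∀ x ∈ I, B.bracket a x ∈ I

/-- A Poisson prime ideal: a proper Poisson ideal `P` such that, for all Poisson ideals `I₁`, `I₂`
with `I₁ I₂ ⊆ P`, one has `I₁ ⊆ P` or `I₂ ⊆ P`. -/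
def IsPoissonPrime (B : PoissonBracket K A) (P : Ideal A) : Prop :=
  P ≠ ⊤ ∧ B.IsPoissonIdeal P ∧
    ∀ I₁ I₂ : Ideal A, B.IsPoissonIdeal I₁ → B.IsPoissonIdeal I₂ →
      I₁ * I₂ ≤ P → I₁ ≤ P ∨ I₂ ≤ P

/-- For a group `H` acting on `A` by algebra automorphisms through `ρ`, the ideal
`(P : H) = ⋂ h, h · P`. -/
def core {H : Type*} [Group H] (ρ : H →* (A ≃ₐ[K] A)) (P : Ideal A) : Ideal A :=
  ⨅ h : H, P.map (ρ h)

/-- The `J`-stratum of the Poisson prime spectrum: all Poisson primes `P` with `(P : H) = J`. -/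
def stratum {H : Type*} [Group H] (B : PoissonBracket K A) (ρ : H →* (A ≃ₐ[K] A)) (J : Ideal A) :
    Set (Ideal A) :=
  {P | B.IsPoissonPrime P ∧ core ρ P = J}

end PoissonBracket

namespace G2

/-- The polynomial algebra `K[X₁, …, X₆]`; the generator `Xᵢ` is `X (i - 1)`. -/
abbrev Alg (K : Type*) [CommRing K] : Type _ := MvPolynomial (Fin 6) K

variable (K : Type*) [Field K]

/-- The brackets `{Xᵢ, Xⱼ}` for `i > j` (and `0` otherwise). -/
noncomputable def lowerBracket : Matrix (Fin 6) (Fin 6) (Alg K) :=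
  let x₁ : Alg K := X 0
  let x₂ : Alg K := X 1
  let x₃ : Alg K := X 2
  let x₄ : Alg K := X 3
  let x₅ : Alg K := X 4
  let x₆ : Alg K := X 5
  !![0, 0, 0, 0, 0, 0;
     -3 * x₁ * x₂, 0, 0, 0, 0, 0;
     -x₁ * x₃ - x₂, -3 * x₂ * x₃, 0, 0, 0, 0;
     -2 * x₃ ^ 2, -3 * x₂ * x₄ - 4 * x₃ ^ 3, -3 * x₃ * x₄, 0, 0, 0;
     x₁ * x₅ - 2 * x₃, -6 * x₃ ^ 2, -x₃ * x₅ - 3 * x₄, -3 * x₄ * x₅, 0, 0;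
     3 * x₁ * x₆ - 3 * x₅, 3 * x₂ * x₆ + 9 * x₄ - 18 * x₃ * x₅, -6 * x₅ ^ 2,
       -3 * x₄ * x₆ - 4 * x₅ ^ 3, -3 * x₅ * x₆, 0]

/-- The skew-symmetric matrix `({Xᵢ, Xⱼ})` of brackets of generators. -/
noncomputable def genBracket (i j : Fin 6) : Alg K := lowerBracket K i j - lowerBracket K j i

/-- The biderivation with the prescribed values on generators:
`{f, g} = ∑ i j, {Xᵢ, Xⱼ} ∂f/∂Xᵢ ∂g/∂Xⱼ`. -/
noncomputable def bracket : Alg K →ₗ[K] Alg K →ₗ[K] Alg K :=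
  LinearMap.mk₂ K (fun f g => ∑ i, ∑ j, genBracket K i j * pderiv i f * pderiv j g)
    (by intro a b c; simp only [map_add, mul_add, add_mul, Finset.sum_add_distrib])
    (by intro r a b
        simp only [Derivation.map_smul, smul_mul_assoc, mul_smul_comm, Finset.smul_sum])
    (by intro a b c; simp only [map_add, mul_add, Finset.sum_add_distrib])
    (by intro r a b
        simp only [Derivation.map_smul, mul_smul_comm, Finset.smul_sum])

theorem bracket_apply (f g : Alg K) :
    bracket K f g = ∑ i, ∑ j, genBracket K i j * pderiv i f * pderiv j g := rfl

theorem bracket_X_X (i j : Fin 6) : bracket K (X i) (X j) = genBracket K i j := by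
  rw [bracket_apply, Finset.sum_eq_single i, Finset.sum_eq_single j]
  · simp
  · intro b _ hb; simp [pderiv_X_of_ne hb.symm]
  · simp
  · intro b _ hb; simp [pderiv_X_of_ne hb.symm]
  · simp

theorem bracket_skew (f g : Alg K) : bracket K f g = -bracket K g f := by
  rw [bracket_apply, bracket_apply, Finset.sum_comm, ← Finset.sum_neg_distrib]
  refine Finset.sum_congr rfl fun i _ => ?_
  rw [← Finset.sum_neg_distrib]
  refine Finset.sum_congr rfl fun j _ => ?_
  simp only [genBracket]
  ring

theorem bracket_leibniz (f g h : Alg K) :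
    bracket K f (g * h) = bracket K f g * h + g * bracket K f h := by
  simp only [bracket_apply, Finset.sum_mul, Finset.mul_sum, ← Finset.sum_add_distrib]
  refine Finset.sum_congr rfl fun i _ => Finset.sum_congr rfl fun j _ => ?_
  simp only [Derivation.leibniz, smul_eq_mul]
  ring

/-- The derivation `{f, -}`. -/
noncomputable def ham (f : Alg K) : Derivation K (Alg K) (Alg K) :=
  Derivation.mk' (bracket K f) (by
    intro a b
    rw [bracket_leibniz]
    simp only [smul_eq_mul]
    ring)

theorem ham_apply (f g : Alg K) : ham K f g = bracket K f g := rfl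

theorem ham_X_X (i j : Fin 6) : ham K (X i) (X j) = genBracket K i j := bracket_X_X K i j

theorem ham_natCast (f : Alg K) (n : ℕ) : ham K f n = 0 := (ham K f).map_natCast n

theorem jacobi_gen_of_lt (i j k : Fin 6) (hij : i < j) (hjk : j < k) :
    ham K (X i) (genBracket K j k) - ham K (X j) (genBracket K i k) =
      -ham K (X k) (genBracket K i j) := by
  have h2 : ∀ f, ham K f 2 = 0 := fun f => ham_natCast K f 2
  have h3 : ∀ f, ham K f 3 = 0 := fun f => ham_natCast K f 3
  have h4 : ∀ f, ham K f 4 = 0 := fun f => ham_natCast K f 4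
  have h6 : ∀ f, ham K f 6 = 0 := fun f => ham_natCast K f 6
  have h9 : ∀ f, ham K f 9 = 0 := fun f => ham_natCast K f 9
  have h18 : ∀ f, ham K f 18 = 0 := fun f => ham_natCast K f 18
  fin_cases i <;> fin_cases j <;> (try (exfalso; revert hij; decide)) <;>
    fin_cases k <;> (try (exfalso; revert hjk; decide)) <;> clear hij hjk <;>
    (simp [genBracket, lowerBracket, ham_X_X, h2, h3, h4, h6, h9, h18, Derivation.leibniz_pow]
     try ring)

theorem jacobi_gen (i j k : Fin 6) :
    bracket K (X i) (bracket K (X j) (X k)) - bracket K (X j) (bracket K (X i) (X k)) =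
      bracket K (bracket K (X i) (X j)) (X k) := by
  rw [bracket_skew K (bracket K (X i) (X j)) (X k)]
  simp only [bracket_X_X]
  simp only [← ham_apply]
  have hs : ∀ a b, genBracket K a b = -genBracket K b a := fun a b => by
    simp [genBracket]
  have h0 : ∀ a, genBracket K a a = 0 := fun a => by simp [genBracket]
  have H := jacobi_gen_of_lt K
  have e : ∀ a b c, ham K (X a) (genBracket K b c) = -ham K (X a) (genBracket K c b) :=
    fun a b c => by rw [hs b c, map_neg]
  rcases lt_trichotomy i j with h | h | h <;> rcases lt_trichotomy j k with h' | h' | h' <;>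
    rcases lt_trichotomy i k with h'' | h'' | h'' <;> (try (exfalso; omega))
  · exact H i j k h h'
  · subst h'; simp [h0]
  · linear_combination e i j k - H i k j h'' h'
  · subst h''; rw [h0, map_zero, e i j i]; ring
  · linear_combination H k i j h'' h + e i j k - e j i k
  · subst h; simp [h0]
  · subst h; simp [h0]
  · subst h; simp [h0]
  · linear_combination e k i j - H j i k h h''
  · subst h''; rw [h0, map_zero, e i j i]; ring
  · linear_combination H j k i h' h'' + e k i j - e j i k
  · subst h'; simp [h0]
  · linear_combination e k i j + e i j k - e j i k - H k j i h' h

theorem jacobi_of_X {f g : Alg K}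
    (h : ∀ k, bracket K f (bracket K g (X k)) - bracket K g (bracket K f (X k)) =
      bracket K (bracket K f g) (X k)) (a : Alg K) :
    bracket K f (bracket K g a) - bracket K g (bracket K f a) = bracket K (bracket K f g) a := by
  have key : ⁅ham K f, ham K g⁆ = ham K (bracket K f g) := by
    refine MvPolynomial.derivation_ext fun k => ?_
    rw [Derivation.commutator_apply]
    exact h k
  have := congrArg (fun D : Derivation K (Alg K) (Alg K) => D a) key
  simpa only [Derivation.commutator_apply, ham_apply] using this

theorem jacobi_rotate {f g k : Alg K}
    (h : bracket K f (bracket K k g) - bracket K k (bracket K f g) = bracket K (bracket K f k) g) :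
    bracket K f (bracket K g k) - bracket K g (bracket K f k) = bracket K (bracket K f g) k := by
  rw [bracket_skew K g k, bracket_skew K g (bracket K f k), bracket_skew K (bracket K f g) k,
    map_neg, ← h]
  ring

theorem jacobi_aux (f g a : Alg K) :
    bracket K f (bracket K g a) - bracket K g (bracket K f a) = bracket K (bracket K f g) a := by
  have h₁ : ∀ (i j : Fin 6) (a : Alg K), bracket K (X i) (bracket K (X j) a) -
      bracket K (X j) (bracket K (X i) a) = bracket K (bracket K (X i) (X j)) a :=
    fun i j => jacobi_of_X K fun k => jacobi_gen K i j k
  have h₂ : ∀ (i : Fin 6) (g a : Alg K), bracket K (X i) (bracket K g a) -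
      bracket K g (bracket K (X i) a) = bracket K (bracket K (X i) g) a :=
    fun i g => jacobi_of_X K fun k => jacobi_rotate K (h₁ i k g)
  refine jacobi_of_X K (fun k => jacobi_rotate K ?_) a
  have := h₂ k f g
  rw [bracket_skew K f (X k), map_neg, LinearMap.neg_apply, ← this]
  ring

/-- The semiclassical limit of `U_q⁺(G₂)`: the Poisson structure on `K[X₁, …, X₆]`. -/
noncomputable def poisson : PoissonBracket K (Alg K) where
  bracket := bracket K
  skew := bracket_skew K
  leibniz := bracket_leibniz K
  jacobi f g h := by
    have := jacobi_aux K f g h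
    rw [bracket_skew K h f, bracket_skew K h (bracket K f g), map_neg, ← this]
    ring

/-- The scalar by which `(α₁, α₆)` acts on each generator. -/
def weight (h : Kˣ × Kˣ) : Fin 6 → K :=
  ![h.1, h.1 ^ 3 * h.2, h.1 ^ 2 * h.2, h.1 ^ 3 * h.2 ^ 2, h.1 * h.2, h.2]

theorem weight_mul (g h : Kˣ × Kˣ) (i : Fin 6) :
    weight K (g * h) i = weight K g i * weight K h i := by
  fin_cases i <;> simp [weight] <;> ring

theorem weight_one (i : Fin 6) : weight K 1 i = 1 := by
  fin_cases i <;> simp [weight]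

/-- The algebra endomorphism `Xᵢ ↦ (weight h i) Xᵢ`. -/
noncomputable def scale (h : Kˣ × Kˣ) : Alg K →ₐ[K] Alg K :=
  aeval fun i => C (weight K h i) * X i

theorem scale_mul (g h : Kˣ × Kˣ) : scale K (g * h) = (scale K g).comp (scale K h) := by
  refine MvPolynomial.algHom_ext fun i => ?_
  simp only [scale, aeval_X, AlgHom.comp_apply, map_mul, algHom_C, weight_mul, algebraMap_eq]
  ring

theorem scale_one : scale K 1 = AlgHom.id K (Alg K) := by
  refine MvPolynomial.algHom_ext fun i => ?_
  simp [scale, weight_one]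

/-- The action of the torus `H = (Kˣ)²` on `K[X₁, …, X₆]` by algebra automorphisms. -/
noncomputable def torusAction : Kˣ × Kˣ →* (Alg K ≃ₐ[K] Alg K) where
  toFun h := AlgEquiv.ofAlgHom (scale K h) (scale K h⁻¹)
    (by rw [← scale_mul, mul_inv_cancel, scale_one])
    (by rw [← scale_mul, inv_mul_cancel, scale_one])
  map_one' := by
    ext1 a
    simp [scale_one]
  map_mul' g h := by
    ext1 a
    simp [scale_mul]

noncomputable def Ω₁ : Alg K :=
  X 0 * X 2 * X 4 - C (3 / 2) * X 0 * X 3 - C (1 / 2) * X 1 * X 4 + C (1 / 2) * X 2 ^ 2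

noncomputable def Ω₂ : Alg K :=
  X 1 * X 3 * X 5 - C (2 / 3) * X 2 ^ 3 * X 5 - C (2 / 3) * X 1 * X 4 ^ 3
    + 2 * X 2 ^ 2 * X 4 ^ 2 - 3 * X 2 * X 3 * X 4 + C (3 / 2) * X 3 ^ 2

end G2

/-! Both statements are instances of one claim about `casimir`, with the roles of Ω₁ and Ω₂
exchanged. The elements Ω₁, Ω₂ are Poisson central, and the four elements X₆, X₅, v = 3X₄X₆ - 2X₅³,
u = 2X₃X₅ - 3X₄ have pairwise brackets that are integer multiples of their products. The integer
matrix is nondegenerate. Moreover v and u are, up to scalars, the coefficients of X₂ in Ω₂ and of X₁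
in Ω₁, so after inverting the four elements 𝒜 is generated by them and their inverses over K[Ω₁, Ω₂]
(`exists_pow_mul_mem_range`).

Let P lie in the stratum of ⟨Ωᵢ⟩. In characteristic zero the minimal primes over a Poisson ideal are
Poisson, so P is an honest prime (`IsPoissonPrime.isPrime`). The four elements and the Ωⱼ are torus
semi-invariants; any of them in P would lie in the core ⟨Ωᵢ⟩, so P contains only Ωᵢ among them.
Nondegeneracy makes P stable under the Euler derivations, hence P is controlled by its central
elements (`le_of_casimir_le`). These come from a prime of K[Ω₁, Ω₂] that contains Ωᵢ but not Ωₖ, and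
over an algebraically closed field it is ⟨Ωᵢ⟩ or ⟨Ωᵢ, Ωₖ - c⟩ with c ≠ 0 (`eq_of_mem_stratum`).

Conversely, the listed ideals are generated by central elements, hence Poisson. They are prime
because 2Ω₁ is linear in X₁ while 6Ω₂ is free of X₁ and linear in X₂ (`isPrime_span_pair`). The core
of ⟨Ωᵢ, Ωₖ - c⟩ is found with the Nullstellensatz: the torus sweeps its zero set over the part of
{Ωᵢ = 0} where Ωₖ ≠ 0. -/

/-! ### Derivations and minimal primes in characteristic zero -/

section Derivation

variable {K A : Type*} [CommRing K] [CommRing A] [Algebra K A]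

theorem Derivation.iterate_mul (D : Derivation K A A) (n : ℕ) (f g : A) :
    D^[n] (f * g) =
      ∑ ij ∈ Finset.HasAntidiagonal.antidiagonal n, (n.choose ij.1 : A) * (D^[ij.1] f * D^[ij.2] g) := by
  induction n with
  | zero => simp
  | succ n ih =>
    rw [Finset.sum_antidiagonal_choose_succ_mul (fun i j => D^[i] f * D^[j] g),
      Function.iterate_succ_apply', ih, map_sum, ← Finset.sum_add_distrib]
    refine Finset.sum_congr rfl fun ij hij => ?_
    rw [Finset.HasAntidiagonal.mem_antidiagonal] at hij
    rw [Nat.choose_symm_of_eq_add hij.symm]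
    simp only [Derivation.leibniz, Derivation.map_natCast, smul_eq_mul, mul_zero, add_zero,
      Function.iterate_succ_apply']
    ring

/-- The largest `D`-stable ideal inside an ideal `Q`. -/
def Ideal.derivationCore (D : Derivation K A A) (Q : Ideal A) : Ideal A where
  carrier := {f | ∀ n, D^[n] f ∈ Q}
  add_mem' {f g} hf hg n := by
    rw [iterate_map_add]
    exact Q.add_mem (hf n) (hg n)
  zero_mem' n := by
    rw [iterate_map_zero]
    exact Q.zero_mem
  smul_mem' a f hf n := by
    rw [smul_eq_mul, D.iterate_mul]
    exact Q.sum_mem fun ij _ => Q.mul_mem_left _ (Q.mul_mem_left _ (hf _))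

theorem Ideal.mem_derivationCore {D : Derivation K A A} {Q : Ideal A} {f : A} :
    f ∈ Q.derivationCore D ↔ ∀ n, D^[n] f ∈ Q := Iff.rfl

theorem Ideal.derivationCore_le (D : Derivation K A A) (Q : Ideal A) : Q.derivationCore D ≤ Q :=
  fun _ hf => hf 0

/-- Take the least n, m with Dⁿf, Dᵐg outside Q. In the Leibniz expansion of the (n+m)-th derivative
of fg every term but one has a factor of lower order, hence in Q; the surviving binomial coefficient
is a unit because ℚ acts. -/
theorem Ideal.derivationCore_isPrime [Algebra ℚ A] (D : Derivation K A A) (Q : Ideal A)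
    [hQ : Q.IsPrime] : (Q.derivationCore D).IsPrime := by
  classical
  refine ⟨fun h => hQ.ne_top (top_le_iff.mp (h ▸ Q.derivationCore_le D)), fun {f g} hfg => ?_⟩
  by_contra! hcon
  obtain ⟨hf, hg⟩ := hcon
  simp only [Ideal.mem_derivationCore, not_forall] at hf hg
  set n := Nat.find hf
  set m := Nat.find hg
  have h := hfg (n + m)
  have hmem : (n, m) ∈ Finset.HasAntidiagonal.antidiagonal (n + m) := by simp
  rw [D.iterate_mul, ← Finset.add_sum_erase _ _ hmem] at h
  have hrest : ∑ ij ∈ (Finset.HasAntidiagonal.antidiagonal (n + m)).erase (n, m),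
      ((n + m).choose ij.1 : A) * (D^[ij.1] f * D^[ij.2] g) ∈ Q := by
    refine Q.sum_mem fun ij hij => Q.mul_mem_left _ ?_
    obtain ⟨i, j⟩ := ij
    simp only [Finset.mem_erase, Finset.HasAntidiagonal.mem_antidiagonal, ne_eq, Prod.mk.injEq] at hij
    rcases lt_or_ge i n with hi | hi
    · exact Q.mul_mem_right _ (not_not.mp (Nat.find_min hf hi))
    · exact Q.mul_mem_left _ (not_not.mp (Nat.find_min hg (by omega)))
  have hmain := (Q.add_mem_iff_left hrest).mp h
  have hunit : IsUnit ((n + m).choose n : A) := by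
    have h0 : ((n + m).choose n : ℚ) ≠ 0 :=
      Nat.cast_ne_zero.mpr (Nat.choose_pos (Nat.le_add_right n m)).ne'
    simpa using (IsUnit.mk0 _ h0).map (algebraMap ℚ A)
  rcases hQ.mem_or_mem ((Q.unit_mul_mem_iff_mem hunit).mp hmain) with h | h
  · exact Nat.find_spec hf h
  · exact Nat.find_spec hg h

/-- In characteristic zero, the minimal primes over a derivation-stable ideal are stable. -/
theorem Ideal.map_mem_of_mem_minimalPrimes [Algebra ℚ A] (D : Derivation K A A) {P Q : Ideal A}
    (hP : ∀ f ∈ P, D f ∈ P) (hQ : Q ∈ P.minimalPrimes) {f : A} (hf : f ∈ Q) : D f ∈ Q := by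
  have := hQ.1.1
  have hle : P ≤ Q.derivationCore D := fun g hg n => by
    refine hQ.1.2 ?_
    induction n with
    | zero => exact hg
    | succ n ih => rw [Function.iterate_succ_apply']; exact hP _ ih
  exact hQ.2 ⟨Q.derivationCore_isPrime D, hle⟩ (Q.derivationCore_le D) hf 1

end Derivation

/-! ### Poisson primes are prime ideals -/

namespace PoissonBracket

variable {K A : Type*} [CommRing K] [CommRing A] [Algebra K A] (B : PoissonBracket K A)

/-- The Hamiltonian derivation `{a, -}`. -/
def hamiltonian (a : A) : Derivation K A A :=
  Derivation.mk' (B.bracket a) (fun x y => by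
    rw [B.leibniz, smul_eq_mul, smul_eq_mul]; ring)

variable {B}

theorem IsPoissonIdeal.mul {I J : Ideal A} (hI : B.IsPoissonIdeal I) (hJ : B.IsPoissonIdeal J) :
    B.IsPoissonIdeal (I * J) := by
  intro a x hx
  induction hx using Submodule.mul_induction_on' with
  | mem_mul_mem i hi j hj =>
    rw [B.leibniz]
    exact add_mem (Ideal.mul_mem_mul (hI a i hi) hj) (Ideal.mul_mem_mul hi (hJ a j hj))
  | add x _ y _ hx hy =>
    rw [map_add]
    exact add_mem hx hy

theorem IsPoissonIdeal.top : B.IsPoissonIdeal ⊤ := fun _ _ _ => Submodule.mem_top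

theorem isPoissonIdeal_span {S : Set A} (hS : ∀ z ∈ S, ∀ a, B.bracket a z = 0) :
    B.IsPoissonIdeal (Ideal.span S) := by
  intro a x hx
  induction hx using Submodule.span_induction with
  | mem x hx => rw [hS x hx a]; exact zero_mem _
  | zero => rw [map_zero]; exact zero_mem _
  | add x y _ _ hx hy => rw [map_add]; exact add_mem hx hy
  | smul r x hx' hx =>
    rw [smul_eq_mul, B.leibniz]
    exact add_mem (Ideal.mul_mem_left _ _ hx') (Ideal.mul_mem_left _ _ hx)

theorem IsPoissonPrime.prod_le {P : Ideal A} (hP : B.IsPoissonPrime P) (s : Multiset (Ideal A))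
    (hs : ∀ I ∈ s, B.IsPoissonIdeal I) (hle : s.prod ≤ P) : ∃ I ∈ s, I ≤ P := by
  have key : ∀ s : Multiset (Ideal A), (∀ I ∈ s, B.IsPoissonIdeal I) →
      B.IsPoissonIdeal s.prod ∧ (s.prod ≤ P → ∃ I ∈ s, I ≤ P) := by
    intro s
    induction s using Multiset.induction_on with
    | empty =>
      intro _
      rw [Multiset.prod_zero, Ideal.one_eq_top]
      exact ⟨IsPoissonIdeal.top, fun h => (hP.1 (top_le_iff.mp h)).elim⟩
    | cons I s ih =>
      intro hs
      obtain ⟨h₁, h₂⟩ := ih fun J hJ => hs J (Multiset.mem_cons_of_mem hJ)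
      have hI := hs I (Multiset.mem_cons_self I s)
      rw [Multiset.prod_cons]
      refine ⟨hI.mul h₁, fun h => ?_⟩
      rcases hP.2.2 I s.prod hI h₁ h with h | h
      · exact ⟨I, Multiset.mem_cons_self I s, h⟩
      · obtain ⟨J, hJ, hJP⟩ := h₂ h
        exact ⟨J, Multiset.mem_cons_of_mem hJ, hJP⟩
  exact (key s hs).2 hle

/-- Over a field of characteristic zero, a Poisson prime ideal of a Noetherian Poisson algebra is a
prime ideal. -/
theorem IsPoissonPrime.isPrime [Algebra ℚ A] [IsNoetherianRing A] {P : Ideal A}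
    (hP : B.IsPoissonPrime P) : P.IsPrime := by
  classical
  obtain ⟨n, hn⟩ := P.exists_radical_pow_le_of_fg P.radical.fg_of_isNoetherianRing
  have hfin := P.finite_minimalPrimes_of_isNoetherianRing A
  -- A power of the radical lies in P, so the product of the finitely many minimal primes, each
  -- repeated n times, does too. These are Poisson ideals, so P contains, and then equals, one of
  -- them.
  have hprod : (n • hfin.toFinset.val).prod ≤ P := by
    rw [Multiset.prod_nsmul]
    refine le_trans (Ideal.pow_right_mono ?_ n) hn
    rw [← P.sInf_minimalPrimes]
    refine le_sInf fun Q hQ => ?_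
    exact Ideal.le_of_dvd (Multiset.dvd_prod (by simpa using hQ))
  have hmem : ∀ I ∈ n • hfin.toFinset.val, I ∈ P.minimalPrimes := fun I hI => by
    simpa using Multiset.mem_of_mem_nsmul hI
  obtain ⟨Q, hQ, hQP⟩ := hP.prod_le _
    (fun I hI a x hx => Ideal.map_mem_of_mem_minimalPrimes (B.hamiltonian a)
      (fun f hf => hP.2.1 a f hf) (hmem I hI) hx) hprod
  have hQ' := (hmem Q hQ).1
  rw [le_antisymm hQ'.2 hQP]
  exact hQ'.1

theorem isPoissonPrime_of_isPrime {P : Ideal A} (h : P.IsPrime) (hP : B.IsPoissonIdeal P) :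
    B.IsPoissonPrime P :=
  ⟨h.ne_top, hP, fun _ _ _ _ => h.mul_le.mp⟩

end PoissonBracket

/-! ### Primality of polynomials linear in one variable -/

section Linear

open Polynomial

/-- Over a domain, `uX + d` is prime as soon as `u` is a nonzero element and `d` is not a zero
divisor modulo `u`. -/
theorem Polynomial.prime_C_mul_X_add_C {R : Type*} [CommRing R] [IsDomain R] {u d : R}
    (hu : u ≠ 0) (h : ∀ g, u ∣ d * g → u ∣ g) :
    Prime (C u * Polynomial.X + C d : R[X]) := by
  set f : R[X] := C u * Polynomial.X + C d with hf
  have hdeg : f.natDegree = 1 := natDegree_linear hu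
  have hf0 : f ≠ 0 := fun h0 => by simp [h0] at hdeg
  have hu' : (C u : R[X]) ≠ 0 := C_ne_zero.mpr hu
  -- Modulo u the polynomial f reduces to d, so u p = f g forces u to divide d times every
  -- coefficient of g, hence g itself.
  have hcancel : ∀ p : R[X], f ∣ C u * p → f ∣ p := by
    rintro p ⟨g, hg⟩
    have hdvd : C u ∣ g := by
      rw [C_dvd_iff_dvd_coeff]
      intro i
      apply h
      have hi : C u ∣ C d * g :=
        ⟨p - Polynomial.X * g, by rw [mul_sub, hg, hf]; ring⟩
      simpa using (C_dvd_iff_dvd_coeff u _).mp hi i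
    obtain ⟨k, rfl⟩ := hdvd
    refine ⟨k, mul_left_cancel₀ hu' ?_⟩
    rw [hg]; ring
  have hcancel' : ∀ (n : ℕ) (p : R[X]), f ∣ C u ^ n * p → f ∣ p := by
    intro n
    induction n with
    | zero => intro p hp; simpa using hp
    | succ n ih => exact fun p hp => ih p (hcancel _ (by rwa [← mul_assoc, ← pow_succ']))
  have hdiv : ∀ p : R[X], ∃ (n : ℕ) (q : R[X]) (r : R), C u ^ n * p = f * q + C r := by
    intro p
    induction p using Polynomial.induction_on' with
    | add p q hp hq =>
      obtain ⟨n, p', r, hp⟩ := hp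
      obtain ⟨m, q', s, hq⟩ := hq
      refine ⟨n + m, C u ^ m * p' + C u ^ n * q', u ^ m * r + u ^ n * s, ?_⟩
      simp only [map_add, map_mul, map_pow]
      linear_combination C u ^ m * hp + C u ^ n * hq
    | monomial k a =>
      induction k with
      | zero => exact ⟨0, 0, a, by simp⟩
      | succ k ih =>
        obtain ⟨n, q, r, hq⟩ := ih
        refine ⟨n + 1, C u * Polynomial.X * q + C r, -(d * r), ?_⟩
        rw [← monomial_mul_X]
        simp only [map_neg, map_mul]
        linear_combination C u * Polynomial.X * hq + C r * hf
  -- Evaluation at the root -d/u. Pseudo-division by f together with cancellation of u shows that f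
  -- generates its kernel, which is prime since the target is a field.
  let φ : R[X] →+* FractionRing R := eval₂RingHom (algebraMap R _)
    (-(algebraMap R (FractionRing R) d) / algebraMap R (FractionRing R) u)
  have hinj := IsFractionRing.injective R (FractionRing R)
  have huF : algebraMap R (FractionRing R) u ≠ 0 := by
    rwa [Ne, map_eq_zero_iff _ hinj]
  have hφf : φ f = 0 := by
    simp only [φ, hf, coe_eval₂RingHom, eval₂_add, eval₂_mul, eval₂_C, eval₂_X]
    field_simp
    ring
  have hker : ∀ p : R[X], φ p = 0 → f ∣ p := by
    intro p hp
    obtain ⟨n, q, r, hq⟩ := hdiv p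
    have h1 := congrArg φ hq
    rw [map_mul, map_add, map_mul, hp, hφf, mul_zero, zero_mul, zero_add] at h1
    have hr : r = 0 := by
      have : φ (C r) = algebraMap R (FractionRing R) r := by simp [φ]
      rw [this] at h1
      exact (map_eq_zero_iff _ hinj).mp h1.symm
    exact hcancel' n p ⟨q, by rw [hq, hr, map_zero, add_zero]⟩
  refine ⟨hf0, fun hunit => ?_, ?_⟩
  · rw [natDegree_eq_zero_of_isUnit hunit] at hdeg
    exact zero_ne_one hdeg
  · rintro p q ⟨g, hg⟩
    have : φ p * φ q = 0 := by rw [← map_mul, hg, map_mul, hφf, zero_mul]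
    exact (mul_eq_zero.mp this).imp (hker p) (hker q)

end Linear

/-! ### Transfer to several variables, and Euler derivations -/

namespace MvPolynomial

theorem finSuccEquiv_rename_succ {K : Type*} [Field K] {n : ℕ}
    (p : MvPolynomial (Fin n) K) :
    finSuccEquiv K n (rename Fin.succ p) = Polynomial.C p := by
  induction p using MvPolynomial.induction_on with
  | C a => simp [finSuccEquiv_apply]
  | add p q hp hq => simp only [map_add, hp, hq]
  | mul_X p i hp => simp only [map_mul, hp, rename_X, finSuccEquiv_X_succ]

/-- A polynomial that is linear in its first variable is prime if its leading coefficient `u` is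
nonzero and its constant coefficient is not a zero divisor modulo `u`. -/
theorem prime_rename_mul_X_zero_add {K : Type*} [Field K] {n : ℕ} {u d : MvPolynomial (Fin n) K}
    (hu : u ≠ 0) (h : ∀ g, u ∣ d * g → u ∣ g) :
    Prime (rename Fin.succ u * X 0 + rename Fin.succ d : MvPolynomial (Fin (n + 1)) K) := by
  rw [← MulEquiv.prime_iff (finSuccEquiv K n).toMulEquiv]
  have := Polynomial.prime_C_mul_X_add_C hu h
  convert this using 1
  change finSuccEquiv K n _ = _
  rw [map_add, map_mul, finSuccEquiv_rename_succ, finSuccEquiv_rename_succ,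
    finSuccEquiv_X_zero]

theorem coeff_X_mul_pderiv {σ R : Type*} [CommRing R] (i : σ) (f : MvPolynomial σ R)
    (m : σ →₀ ℕ) : coeff m (X i * pderiv i f) = m i * coeff m f := by
  classical
  induction f using MvPolynomial.induction_on' with
  | monomial k a =>
    rw [X_mul_pderiv_monomial, coeff_smul, coeff_monomial]
    split_ifs with h
    · rw [h, nsmul_eq_mul]
    · simp
  | add p q hp hq => rw [map_add, mul_add, coeff_add, coeff_add, hp, hq, mul_add]

/-- A submodule stable under the Euler derivations `Xᵢ ∂/∂Xᵢ` contains the monomial components of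
its elements. -/
theorem monomial_coeff_mem_of_euler {σ R : Type*} [CommRing R] [Algebra ℚ R]
    (Q : Submodule R (MvPolynomial σ R)) (hQ : ∀ i, ∀ f ∈ Q, X i * pderiv i f ∈ Q)
    {f : MvPolynomial σ R} (hf : f ∈ Q) (m : σ →₀ ℕ) : monomial m (coeff m f) ∈ Q := by
  classical
  induction hn : f.support.card using Nat.strong_induction_on generalizing f with
  | _ n ih =>
    by_cases hm : ∃ k ∈ f.support, k ≠ m
    · obtain ⟨k, hk, hkm⟩ := hm
      obtain ⟨i, hi⟩ := Finsupp.ne_iff.mp hkm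
      -- This kills the monomial k and multiplies the coefficient at m by the nonzero integer m i -
      -- k i, so the support shrinks and m can still be recovered.
      set g := X i * pderiv i f - (k i : R) • f with hg
      have hcoeff : ∀ l, coeff l g = ((l i : R) - k i) * coeff l f := fun l => by
        rw [hg, coeff_sub, coeff_X_mul_pderiv, coeff_smul, smul_eq_mul, sub_mul]
      have hgQ : g ∈ Q := Q.sub_mem (hQ i f hf) (Q.smul_mem _ hf)
      have hsupp : g.support ⊂ f.support := by
        refine (Finset.ssubset_iff_of_subset fun l hl => ?_).mpr ⟨k, hk, ?_⟩
        · rw [mem_support_iff, hcoeff] at hl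
          exact mem_support_iff.mpr (right_ne_zero_of_mul hl)
        · rw [notMem_support_iff, hcoeff, sub_self, zero_mul]
      have h := ih _ (hn ▸ Finset.card_lt_card hsupp) hgQ rfl
      rw [hcoeff] at h
      have hne : ((m i : ℚ) - k i) ≠ 0 := sub_ne_zero.mpr (by exact_mod_cast hi.symm)
      have h' := Q.smul_mem (algebraMap ℚ R ((m i : ℚ) - k i)⁻¹) h
      rw [smul_monomial, smul_eq_mul, ← mul_assoc] at h'
      have h1 : algebraMap ℚ R ((m i : ℚ) - k i)⁻¹ * ((m i : R) - k i) = 1 := by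
        have : ((m i : R) - k i) = algebraMap ℚ R ((m i : ℚ) - k i) := by simp
        rw [this, ← map_mul, inv_mul_cancel₀ hne, map_one]
      rwa [h1, one_mul] at h'
    · push Not at hm
      convert hf using 1
      ext l
      rw [coeff_monomial]
      split_ifs with h
      · rw [h]
      · by_contra hl
        exact h (hm l (mem_support_iff.mpr (Ne.symm hl))).symm

end MvPolynomial

/-! ### Primality of an ideal with one linear generator -/

section LinearPair

-- The ideal is the preimage of the principal ideal of the reduced linear polynomial under reduction
-- modulo t, and over the domain R/(t) the linear criterion applies.
open Polynomial in
theorem Polynomial.isPrime_span_pair {R : Type*} [CommRing R] {t u d : R}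
    (ht : (Ideal.span {t}).IsPrime) (hu : u ∉ Ideal.span {t})
    (h : ∀ g, d * g ∈ Ideal.span {u, t} → g ∈ Ideal.span {u, t}) :
    (Ideal.span {C u * Polynomial.X + C d, C t} : Ideal R[X]).IsPrime := by
  set S := R ⧸ Ideal.span {t}
  have hdvd : ∀ a b : R, Ideal.Quotient.mk (Ideal.span {t}) a ∣ Ideal.Quotient.mk _ b ↔
      b ∈ Ideal.span {a, t} := by
    intro a b
    rw [Ideal.mem_span_pair]
    constructor
    · rintro ⟨k, hk⟩
      obtain ⟨k, rfl⟩ := Ideal.Quotient.mk_surjective k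
      rw [← map_mul, Ideal.Quotient.eq, Ideal.mem_span_singleton'] at hk
      obtain ⟨l, hl⟩ := hk
      exact ⟨k, l, by linear_combination hl⟩
    · rintro ⟨k, l, rfl⟩
      refine ⟨Ideal.Quotient.mk _ k, ?_⟩
      rw [← map_mul, Ideal.Quotient.eq, Ideal.mem_span_singleton']
      exact ⟨l, by ring⟩
  have hprime : Prime (C (Ideal.Quotient.mk (Ideal.span {t}) u) * Polynomial.X +
      C (Ideal.Quotient.mk (Ideal.span {t}) d)) := by
    refine Polynomial.prime_C_mul_X_add_C ?_ fun g hg => ?_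
    · rwa [Ne, Ideal.Quotient.eq_zero_iff_mem]
    · obtain ⟨g, rfl⟩ := Ideal.Quotient.mk_surjective g
      rw [← map_mul, hdvd] at hg
      exact (hdvd _ _).mpr (h g hg)
  rw [← Ideal.span_singleton_prime hprime.ne_zero] at hprime
  let π : R[X] →+* S[X] := Polynomial.mapRingHom (Ideal.Quotient.mk (Ideal.span {t}))
  have hπ : Function.Surjective π := Polynomial.map_surjective _ Ideal.Quotient.mk_surjective
  have hker : RingHom.ker π = Ideal.span {C t} := by
    rw [Polynomial.ker_mapRingHom, Ideal.mk_ker, Ideal.map_span, Set.image_singleton]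
  have heq : (Ideal.span {C u * Polynomial.X + C d, C t} : Ideal R[X]) =
      Ideal.comap π (Ideal.span {C (Ideal.Quotient.mk (Ideal.span {t}) u) * Polynomial.X +
        C (Ideal.Quotient.mk (Ideal.span {t}) d)}) := by
    rw [Ideal.span_insert, ← hker, ← Ideal.comap_map_of_surjective' π hπ, Ideal.map_span,
      Set.image_singleton]
    simp [π]
  rw [heq]
  exact Ideal.comap_isPrime π _

namespace MvPolynomial

variable {K : Type*} [Field K]

theorem isPrime_span_pair_rename {n : ℕ} {t u d : MvPolynomial (Fin n) K}
    (ht : Prime t) (hu : u ∉ Ideal.span {t})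
    (h : ∀ g, d * g ∈ Ideal.span {u, t} → g ∈ Ideal.span {u, t}) :
    (Ideal.span {rename Fin.succ u * X 0 + rename Fin.succ d, rename Fin.succ t} :
      Ideal (MvPolynomial (Fin (n + 1)) K)).IsPrime := by
  rw [← Ideal.span_singleton_prime ht.ne_zero] at ht
  have := Polynomial.isPrime_span_pair ht hu h
  have heq : (Ideal.span {rename Fin.succ u * X 0 + rename Fin.succ d, rename Fin.succ t} :
      Ideal (MvPolynomial (Fin (n + 1)) K)) = Ideal.comap (finSuccEquiv K n).toRingEquiv
        (Ideal.span {Polynomial.C u * Polynomial.X + Polynomial.C d, Polynomial.C t}) := by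
    rw [← Ideal.map_symm, Ideal.map_span, Set.image_pair]
    congr 2
    · refine (RingEquiv.eq_symm_apply _).mpr ?_
      change finSuccEquiv K n _ = _
      rw [map_add, map_mul, finSuccEquiv_rename_succ, finSuccEquiv_rename_succ,
        finSuccEquiv_X_zero]
    · rw [Set.singleton_eq_singleton_iff]
      refine (RingEquiv.eq_symm_apply _).mpr ?_
      change finSuccEquiv K n _ = _
      exact finSuccEquiv_rename_succ t
  rw [heq]
  exact Ideal.comap_isPrime _ _

theorem prime_rename_equiv_iff {σ : Type*} (e : σ ≃ σ) {p : MvPolynomial σ K} :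
    Prime (rename e p) ↔ Prime p :=
  MulEquiv.prime_iff (renameEquiv K e).toMulEquiv

theorem not_dvd_of_eval {σ : Type*} (x : σ → K) {p q : MvPolynomial σ K} (hp : eval x p = 0)
    (hq : eval x q ≠ 0) : ¬ p ∣ q := by
  rintro ⟨r, rfl⟩
  simp [hp] at hq

theorem prime_C_mul {σ : Type*} {c : K} (hc : c ≠ 0) {p : MvPolynomial σ K} (hp : Prime p) :
    Prime (C c * p) :=
  ((associated_isUnit_mul_left_iff ((isUnit_iff_ne_zero.mpr hc).map C)).mpr
    (Associated.refl p)).symm.prime hp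

end MvPolynomial

end LinearPair

/-! ### Primality of the ideals generated by Ω₁ and Ω₂, up to constants -/

namespace G2

variable (K : Type*) [Field K]

/-- The leading coefficient of `6 Ω₂` with respect to `X₂`, in the variables `X₃, …, X₆`. -/
noncomputable def leadΩ₂ : MvPolynomial (Fin 4) K := 6 * X 1 * X 3 - 4 * X 2 ^ 3

/-- The part of `6 Ω₂` free of `X₂`, in the variables `X₃, …, X₆`. -/
noncomputable def constΩ₂ : MvPolynomial (Fin 4) K :=
  -4 * X 0 ^ 3 * X 3 + 12 * X 0 ^ 2 * X 2 ^ 2 - 18 * X 0 * X 1 * X 2 + 9 * X 1 ^ 2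

/-- The leading coefficient of `2 Ω₁` with respect to `X₁`, in the variables `X₂, …, X₆`. -/
noncomputable def leadΩ₁ : MvPolynomial (Fin 5) K := 2 * X 1 * X 3 - 3 * X 2

/-- The part of `2 Ω₁` free of `X₁`, in the variables `X₂, …, X₆`. -/
noncomputable def constΩ₁ : MvPolynomial (Fin 5) K := X 1 ^ 2 - X 0 * X 3

/-- The polynomial `6 Ω₂` in the variables `X₂, …, X₆`. -/
noncomputable def sixΩ₂ : MvPolynomial (Fin 5) K :=
  rename Fin.succ (leadΩ₂ K) * X 0 + rename Fin.succ (constΩ₂ K)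

/-- The polynomial `X₃ X₆ - X₅²` in the variables `X₂, …, X₆`. -/
noncomputable def quadric : MvPolynomial (Fin 5) K := X 1 * X 4 - X 3 ^ 2

theorem sixΩ₂_eq : sixΩ₂ K =
    6 * X 0 * X 2 * X 4 - 4 * X 1 ^ 3 * X 4 - 4 * X 0 * X 3 ^ 3 + 12 * X 1 ^ 2 * X 3 ^ 2
      - 18 * X 1 * X 2 * X 3 + 9 * X 2 ^ 2 := by
  simp only [sixΩ₂, leadΩ₂, constΩ₂, map_add, map_sub, map_mul, map_pow, rename_X, map_neg,
    map_ofNat]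
  simp only [show (0 : Fin 4).succ = 1 from rfl, show (1 : Fin 4).succ = 2 from rfl,
    show (2 : Fin 4).succ = 3 from rfl, show (3 : Fin 4).succ = 4 from rfl]
  ring

/-- Modulo the leading coefficient of 2Ω₁, 6Ω₂ factors, with the constant term of 2Ω₁ as a factor.
Both non-zero-divisor checks rest on this. -/
theorem sixΩ₂_mod_lead : sixΩ₂ K = -4 * constΩ₁ K * quadric K +
    leadΩ₁ K * (-2 * X 0 * X 4 + 4 * X 1 * X 3 - 3 * X 2) := by
  rw [sixΩ₂_eq, constΩ₁, quadric, leadΩ₁]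
  ring

variable {K}

theorem prime_quadric : Prime (quadric K) := by
  -- The linear criterion singles out variable 0, so a variable of degree one is moved there.
  rw [← prime_rename_equiv_iff (Equiv.swap 0 4)]
  have h : rename (Equiv.swap 0 4) (quadric K) =
      rename Fin.succ (X 0) * X 0 + rename Fin.succ (-X 2 ^ 2) := by
    simp only [quadric, map_sub, map_mul, map_pow, rename_X, map_neg, Equiv.swap_apply_right]
    rw [Equiv.swap_apply_of_ne_of_ne (by decide) (by decide),
      Equiv.swap_apply_of_ne_of_ne (by decide) (by decide)]
    simp only [show (0 : Fin 4).succ = 1 from rfl, show (2 : Fin 4).succ = 3 from rfl]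
    ring
  rw [h]
  refine prime_rename_mul_X_zero_add (X_ne_zero 0) fun g hg =>
    (X_prime.dvd_or_dvd hg).resolve_left ?_
  exact not_dvd_of_eval (Pi.single 2 1) (by simp) (by simp)

/-- Modulo the ideal, -4 `constΩ₁` `quadric` equals the nonzero constant b, so `constΩ₁` is a unit
there. -/
theorem mem_of_constΩ₁_mul_mem {b : K} (hb : b ≠ 0) {g : MvPolynomial (Fin 5) K}
    (hg : constΩ₁ K * g ∈ Ideal.span {leadΩ₁ K, sixΩ₂ K - C b}) :
    g ∈ Ideal.span {leadΩ₁ K, sixΩ₂ K - C b} := by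
  set I := Ideal.span {leadΩ₁ K, sixΩ₂ K - C b}
  have h1 : leadΩ₁ K ∈ I := Ideal.subset_span (by simp)
  have h2 : sixΩ₂ K - C b ∈ I := Ideal.subset_span (by simp)
  have h3 : C b * g ∈ I := by
    have : C b * g = (-4 * quadric K) * (constΩ₁ K * g) +
        (g * (-2 * X 0 * X 4 + 4 * X 1 * X 3 - 3 * X 2)) * leadΩ₁ K - g * (sixΩ₂ K - C b) := by
      rw [sixΩ₂_mod_lead]
      ring
    rw [this]
    exact I.sub_mem (I.add_mem (I.mul_mem_left _ hg) (I.mul_mem_left _ h1)) (I.mul_mem_left _ h2)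
  exact (I.unit_mul_mem_iff_mem ((isUnit_iff_ne_zero.mpr hb).map C)).mp h3

variable (K) in
/-- The substitution `X₄ ↦ (2/3) X₃ X₅`, which solves `leadΩ₁ = 0`. -/
noncomputable def solveLead : MvPolynomial (Fin 5) K →ₐ[K] MvPolynomial (Fin 5) K :=
  aeval ![X 0, X 1, C (2 / 3) * X 1 * X 3, X 3, X 4]

theorem solveLead_constΩ₁ : solveLead K (constΩ₁ K) = constΩ₁ K := by
  simp [solveLead, constΩ₁]

theorem solveLead_quadric : solveLead K (quadric K) = quadric K := by
  simp [solveLead, quadric]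

variable [CharZero K]

theorem prime_leadΩ₁ : Prime (leadΩ₁ K) := by
  rw [← prime_rename_equiv_iff (Equiv.swap 0 2)]
  have h : rename (Equiv.swap 0 2) (leadΩ₁ K) =
      rename Fin.succ (C (-3)) * X 0 + rename Fin.succ (2 * X 0 * X 2) := by
    simp only [leadΩ₁, map_sub, map_mul, rename_X, map_neg, Equiv.swap_apply_right,
      map_ofNat]
    rw [Equiv.swap_apply_of_ne_of_ne (by decide) (by decide),
      Equiv.swap_apply_of_ne_of_ne (by decide) (by decide)]
    simp only [show (0 : Fin 4).succ = 1 from rfl, show (2 : Fin 4).succ = 3 from rfl]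
    ring
  rw [h]
  refine prime_rename_mul_X_zero_add (by simp) fun g _ => IsUnit.dvd ?_
  exact (isUnit_iff_ne_zero.mpr (by simp)).map C

theorem prime_leadΩ₂ : Prime (leadΩ₂ K) := by
  rw [← prime_rename_equiv_iff (Equiv.swap 0 1)]
  have h : rename (Equiv.swap 0 1) (leadΩ₂ K) =
      rename Fin.succ (C 6 * X 2) * X 0 + rename Fin.succ (-4 * X 1 ^ 3) := by
    simp only [leadΩ₂, map_sub, map_mul, map_pow, rename_X, map_neg, Equiv.swap_apply_right,
      map_ofNat]
    rw [Equiv.swap_apply_of_ne_of_ne (by decide) (by decide),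
      Equiv.swap_apply_of_ne_of_ne (by decide) (by decide)]
    simp only [show (1 : Fin 3).succ = 2 from rfl, show (2 : Fin 3).succ = 3 from rfl]
    ring
  rw [h]
  have hp : Prime (C 6 * X 2 : MvPolynomial (Fin 3) K) := prime_C_mul (by simp) X_prime
  refine prime_rename_mul_X_zero_add hp.ne_zero fun g hg => (hp.dvd_or_dvd hg).resolve_left ?_
  exact not_dvd_of_eval (Pi.single 1 1) (by simp) (by simp)

theorem prime_sixΩ₂_sub (b : K) : Prime (sixΩ₂ K - C b) := by
  have h : sixΩ₂ K - C b =
      rename Fin.succ (leadΩ₂ K) * X 0 + rename Fin.succ (constΩ₂ K - C b) := by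
    rw [sixΩ₂, map_sub, rename_C]
    ring
  rw [h]
  refine prime_rename_mul_X_zero_add prime_leadΩ₂.ne_zero fun g hg =>
    (prime_leadΩ₂.dvd_or_dvd hg).resolve_left ?_
  -- The leading coefficient vanishes at both points used, where the constant part takes the values
  -- 9 - b and -b; these are not both zero.
  by_cases hb : b = 0
  · exact not_dvd_of_eval (Pi.single 1 1) (by simp [leadΩ₂]) (by simp [constΩ₂, hb])
  · exact not_dvd_of_eval 0 (by simp [leadΩ₂]) (by simp [constΩ₂, hb])

theorem leadΩ₁_notMem (b : K) : leadΩ₁ K ∉ Ideal.span {sixΩ₂ K - C b} := by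
  rw [Ideal.mem_span_singleton]
  -- With the last four coordinates fixed at 0, 1, 1, 2, `sixΩ₂` becomes 8X₂ + 9, which determines
  -- the first.
  refine not_dvd_of_eval ![(b - 9) / 8, 0, 1, 1, 2] ?_ ?_
  · simp [sixΩ₂_eq]
    ring
  · simp [leadΩ₁]

theorem C_two_thirds : 3 * C (2 / 3) = (2 : MvPolynomial (Fin 5) K) := by
  rw [← map_ofNat (C : K →+* _) 3, ← C_mul, ← map_ofNat (C : K →+* _) 2]
  congr 1
  field_simp

theorem solveLead_leadΩ₁ : solveLead K (leadΩ₁ K) = 0 := by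
  simp only [solveLead, leadΩ₁, map_sub, map_mul, map_ofNat, aeval_X]
  simp
  linear_combination (-X 1 * X 3) * C_two_thirds (K := K)

/-- The substitution changes nothing modulo `leadΩ₁`; hence its kernel lies in ⟨`leadΩ₁`⟩, and
identities proved after substituting can be lifted back. -/
theorem sub_solveLead_mem (f : MvPolynomial (Fin 5) K) :
    f - solveLead K f ∈ Ideal.span {leadΩ₁ K} := by
  have h : (Ideal.Quotient.mkₐ K (Ideal.span {leadΩ₁ K})) =
      (Ideal.Quotient.mkₐ K (Ideal.span {leadΩ₁ K})).comp (solveLead K) := by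
    refine algHom_ext fun i => ?_
    simp only [AlgHom.comp_apply, solveLead, aeval_X]
    fin_cases i
    · rfl
    · rfl
    · refine (Ideal.Quotient.eq).mpr (Ideal.mem_span_singleton'.mpr ⟨C (-1 / 3), ?_⟩)
      have h3 : (3 : MvPolynomial (Fin 5) K) * C (-1 / 3) = -1 := by
        rw [← map_ofNat (C : K →+* _) 3, ← C_mul, ← C_1, ← C_neg]
        congr 1
        field_simp
      have h2 : C (2 / 3) = (-2 : MvPolynomial (Fin 5) K) * C (-1 / 3) := by
        linear_combination C (2 / 3) * h3 - C (-1 / 3) * C_two_thirds (K := K)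
      simp [leadΩ₁]
      linear_combination X 1 * X 3 * h2 - X 2 * h3
    · rfl
    · rfl
  exact Ideal.Quotient.eq.mp (DFunLike.congr_fun h f)

/-- After eliminating X₄, the ideal becomes principal on `constΩ₁ * quadric`, and `constΩ₁ - a`
shares no factor with it: it is a nonzero constant modulo `constΩ₁`, and the prime `quadric` does
not divide it. -/
theorem mem_of_constΩ₁_sub_mul_mem {a : K} (ha : a ≠ 0) {g : MvPolynomial (Fin 5) K}
    (hg : (constΩ₁ K - C a) * g ∈ Ideal.span {leadΩ₁ K, sixΩ₂ K - C 0}) :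
    g ∈ Ideal.span {leadΩ₁ K, sixΩ₂ K - C 0} := by
  rw [C_0, sub_zero] at hg ⊢
  obtain ⟨k, l, hkl⟩ := Ideal.mem_span_pair.mp hg
  have hσ := congrArg (solveLead K) hkl
  rw [sixΩ₂_mod_lead] at hσ
  simp only [map_add, map_mul, map_sub, solveLead_leadΩ₁, solveLead_constΩ₁, solveLead_quadric,
    zero_mul, mul_zero, add_zero, zero_add, algHom_C, algebraMap_eq, map_neg, map_ofNat] at hσ
  have hunit : IsUnit (C a : MvPolynomial (Fin 5) K) := (isUnit_iff_ne_zero.mpr ha).map C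
  have hdvd : constΩ₁ K ∣ solveLead K g := by
    rw [← hunit.dvd_mul_left]
    exact ⟨solveLead K g + 4 * quadric K * solveLead K l, by linear_combination hσ⟩
  obtain ⟨g', hg'⟩ := hdvd
  have hconst : constΩ₁ K ≠ 0 := fun h => by
    have := congrArg (eval (Pi.single 1 1)) h
    simp [constΩ₁] at this
  rw [hg'] at hσ
  have hσ' : (constΩ₁ K - C a) * g' = quadric K * (-4 * solveLead K l) :=
    mul_left_cancel₀ hconst (by linear_combination -hσ)
  obtain ⟨m, rfl⟩ := (prime_quadric.dvd_or_dvd ⟨_, hσ'⟩).resolve_left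
    (not_dvd_of_eval 0 (by simp [quadric]) (by simp [constΩ₁, ha]))
  obtain ⟨r, hr⟩ := Ideal.mem_span_singleton'.mp (sub_solveLead_mem g)
  have h4 : (4 : MvPolynomial (Fin 5) K) * C (1 / 4) = 1 := by
    rw [← map_ofNat (C : K →+* _) 4, ← C_mul, ← C_1]
    congr 1
    field_simp
  refine Ideal.mem_span_pair.mpr
    ⟨r + C (1 / 4) * m * (-2 * X 0 * X 4 + 4 * X 1 * X 3 - 3 * X 2), -C (1 / 4) * m, ?_⟩
  rw [sixΩ₂_mod_lead]
  linear_combination hr - hg' + constΩ₁ K * quadric K * m * h4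

/-- The ideal generated by `2 Ω₁ - a` and `6 Ω₂ - b` is prime if exactly one of `a`, `b` is zero. -/
theorem isPrime_span_pair_scaled {a b : K} (hab : a = 0 ∧ b ≠ 0 ∨ a ≠ 0 ∧ b = 0) :
    (Ideal.span {rename Fin.succ (leadΩ₁ K) * X 0 + rename Fin.succ (constΩ₁ K - C a),
      rename Fin.succ (sixΩ₂ K - C b)} : Ideal (Alg K)).IsPrime := by
  refine isPrime_span_pair_rename (prime_sixΩ₂_sub b) (leadΩ₁_notMem b) fun g hg => ?_
  rcases hab with ⟨rfl, hb⟩ | ⟨ha, rfl⟩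
  · rw [C_0, sub_zero] at hg
    exact mem_of_constΩ₁_mul_mem hb hg
  · exact mem_of_constΩ₁_sub_mul_mem ha hg

theorem two_mul_Ω₁ : 2 * Ω₁ K =
    2 * X 0 * X 2 * X 4 - 3 * X 0 * X 3 - X 1 * X 4 + X 2 ^ 2 := by
  have h1 : (2 : Alg K) * C (1 / 2) = 1 := by
    rw [← map_ofNat (C : K →+* _) 2, ← C_mul, ← C_1]
    congr 1
    field_simp
  have h2 : (2 : Alg K) * C (3 / 2) = 3 := by
    rw [← map_ofNat (C : K →+* _) 2, ← C_mul, ← map_ofNat (C : K →+* _) 3]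
    congr 1
    field_simp
  rw [Ω₁]
  linear_combination (-X 0 * X 3) * h2 + (X 2 ^ 2 - X 1 * X 4) * h1

theorem six_mul_Ω₂ : 6 * Ω₂ K =
    6 * X 1 * X 3 * X 5 - 4 * X 2 ^ 3 * X 5 - 4 * X 1 * X 4 ^ 3 + 12 * X 2 ^ 2 * X 4 ^ 2
      - 18 * X 2 * X 3 * X 4 + 9 * X 3 ^ 2 := by
  have h1 : (6 : Alg K) * C (2 / 3) = 4 := by
    rw [← map_ofNat (C : K →+* _) 6, ← C_mul, ← map_ofNat (C : K →+* _) 4]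
    congr 1
    norm_num
  have h2 : (6 : Alg K) * C (3 / 2) = 9 := by
    rw [← map_ofNat (C : K →+* _) 6, ← C_mul, ← map_ofNat (C : K →+* _) 9]
    congr 1
    norm_num
  rw [Ω₂]
  linear_combination (-X 2 ^ 3 * X 5 - X 1 * X 4 ^ 3) * h1 + X 3 ^ 2 * h2

theorem two_mul_Ω₁_eq_linear : 2 * Ω₁ K =
    rename Fin.succ (leadΩ₁ K) * X 0 + rename Fin.succ (constΩ₁ K) := by
  rw [two_mul_Ω₁]
  simp only [leadΩ₁, constΩ₁, map_sub, map_mul, map_pow, rename_X, map_ofNat]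
  simp only [show (0 : Fin 5).succ = 1 from rfl, show (1 : Fin 5).succ = 2 from rfl,
    show (2 : Fin 5).succ = 3 from rfl, show (3 : Fin 5).succ = 4 from rfl]
  ring

theorem six_mul_Ω₂_eq_rename : 6 * Ω₂ K = rename Fin.succ (sixΩ₂ K) := by
  rw [six_mul_Ω₂, sixΩ₂_eq]
  simp only [map_add, map_sub, map_mul, map_pow, rename_X, map_ofNat]
  simp only [show (0 : Fin 5).succ = 1 from rfl, show (1 : Fin 5).succ = 2 from rfl,
    show (2 : Fin 5).succ = 3 from rfl, show (3 : Fin 5).succ = 4 from rfl,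
    show (4 : Fin 5).succ = 5 from rfl]

theorem isPrime_span_pair {α β : K} (h : α = 0 ∧ β ≠ 0 ∨ α ≠ 0 ∧ β = 0) :
    (Ideal.span {Ω₁ K - C α, Ω₂ K - C β}).IsPrime := by
  have key := isPrime_span_pair_scaled (K := K) (a := 2 * α) (b := 6 * β) (by simpa using h)
  have h1 : rename Fin.succ (leadΩ₁ K) * X 0 + rename Fin.succ (constΩ₁ K - C (2 * α)) =
      C 2 * (Ω₁ K - C α) := by
    rw [map_sub, rename_C, C_mul, mul_sub, map_ofNat, two_mul_Ω₁_eq_linear]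
    ring
  have h2 : rename Fin.succ (sixΩ₂ K - C (6 * β)) = C 6 * (Ω₂ K - C β) := by
    rw [map_sub, rename_C, C_mul, mul_sub, map_ofNat, six_mul_Ω₂_eq_rename]
  rw [h1, h2, Ideal.span_insert, Ideal.span_singleton_mul_left_unit,
    Ideal.span_singleton_mul_left_unit, ← Ideal.span_insert] at key
  · exact key
  · exact (isUnit_iff_ne_zero.mpr (by simp)).map C
  · exact (isUnit_iff_ne_zero.mpr (by simp)).map C

theorem prime_Ω₁ : Prime (Ω₁ K) := by
  have h : Prime (C 2 * Ω₁ K) := by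
    rw [map_ofNat, two_mul_Ω₁_eq_linear]
    refine prime_rename_mul_X_zero_add prime_leadΩ₁.ne_zero fun g hg =>
      (prime_leadΩ₁.dvd_or_dvd hg).resolve_left ?_
    exact not_dvd_of_eval (Pi.single 1 1) (by simp [leadΩ₁]) (by simp [constΩ₁])
  exact ((associated_isUnit_mul_left_iff ((isUnit_iff_ne_zero.mpr (by simp)).map C)).mpr
    (Associated.refl _)).prime h

theorem prime_Ω₂ : Prime (Ω₂ K) := by
  have h : Prime (C 6 * Ω₂ K) := by
    rw [map_ofNat, six_mul_Ω₂_eq_rename, ← MulEquiv.prime_iff (finSuccEquiv K 5).toMulEquiv]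
    change Prime (finSuccEquiv K 5 _)
    rw [finSuccEquiv_rename_succ, Polynomial.prime_C_iff]
    simpa using prime_sixΩ₂_sub (K := K) 0
  exact ((associated_isUnit_mul_left_iff ((isUnit_iff_ne_zero.mpr (by simp)).map C)).mpr
    (Associated.refl _)).prime h

end G2

/-! ### Log-canonical elements and the ring of Casimirs -/

namespace G2

variable (K : Type*) [Field K]

/-- The two generators `Ω₁`, `Ω₂` of the Poisson centre. -/
noncomputable def casimir : Fin 2 → Alg K := ![Ω₁ K, Ω₂ K]

/-- The log-canonical family `X₆`, `X₅`, `3 X₄ X₆ - 2 X₅³`, `2 X₃ X₅ - 3 X₄`. -/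
noncomputable def logCoord : Fin 4 → Alg K :=
  ![X 5, X 4, 3 * X 3 * X 5 - 2 * X 4 ^ 3, 2 * X 2 * X 4 - 3 * X 3]

/-- The coefficients of the log-canonical brackets of the family `logCoord`. -/
def logMatrix : Matrix (Fin 4) (Fin 4) ℤ :=
  !![0, -3, -3, -3; 3, 0, 0, -1; 3, 0, 0, -3; 3, 1, 3, 0]

variable {K}

theorem ham_X_right (f : Alg K) (i : Fin 6) : ham K f (X i) = -ham K (X i) f :=
  bracket_skew K _ _

theorem ham_ofNat (f : Alg K) (n : ℕ) [n.AtLeastTwo] : ham K f ofNat(n) = 0 :=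
  ham_natCast K f n

theorem ham_X_four_logCoord_two : ham K (X 4) (logCoord K 2) = 0 := by
  simp [logCoord, ham_X_X, ham_ofNat, Derivation.leibniz_pow, genBracket, lowerBracket]
  ring

theorem ham_X_logCoord_two (i : Fin 6) (hi : i = 2 ∨ i = 3) :
    ham K (X i) (logCoord K 2) = 3 * X i * logCoord K 2 := by
  rcases hi with rfl | rfl <;>
  · simp [logCoord, ham_X_X, ham_ofNat, Derivation.leibniz_pow, genBracket, lowerBracket]
    ring

variable (K) in
/-- The embedding of the polynomial ring in `Ω₁`, `Ω₂`. -/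
noncomputable def casimirHom : MvPolynomial (Fin 2) K →ₐ[K] Alg K := aeval (casimir K)

variable (K) in
/-- The map from the polynomial ring in the log-canonical family over the ring of Casimirs. -/
noncomputable def logHom : MvPolynomial (Fin 4) (MvPolynomial (Fin 2) K) →+* Alg K :=
  eval₂Hom (casimirHom K : MvPolynomial (Fin 2) K →+* Alg K) (logCoord K)

theorem logHom_C (r : MvPolynomial (Fin 2) K) : logHom K (C r) = casimirHom K r := by
  simp [logHom]

theorem logHom_X (i : Fin 4) : logHom K (X i) = logCoord K i := by
  simp [logHom]

theorem logHom_intCast (n : ℤ) : logHom K (n : MvPolynomial (Fin 4) (MvPolynomial (Fin 2) K)) = n :=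
  map_intCast _ n

theorem logMatrix_skew (j k : Fin 4) : logMatrix j k = -logMatrix k j := by
  fin_cases j <;> fin_cases k <;> rfl

theorem ham_logCoord_of_lt {j k : Fin 4} (hjk : j < k) : ham K (logCoord K j) (logCoord K k) =
    logMatrix j k * logCoord K j * logCoord K k := by
  by_cases hj : j = 2
  -- For {v, u} only u is expanded; v stays closed since X₃, X₄, X₅ each bracket with v to a
  -- multiple of v.
  · obtain rfl : k = 3 := by omega
    subst hj
    have h3 : logCoord K 3 = 2 * X 2 * X 4 - 3 * X 3 := rfl
    have hm : logMatrix 2 3 = -3 := rfl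
    simp only [h3, hm, map_sub, Derivation.leibniz, ham_ofNat, ham_X_right, smul_eq_mul,
      ham_X_four_logCoord_two, ham_X_logCoord_two 2 (Or.inl rfl),
      ham_X_logCoord_two 3 (Or.inr rfl)]
    push_cast
    ring
  · fin_cases j <;> fin_cases k <;> (try (exfalso; revert hjk; decide)) <;>
      (try (exfalso; revert hj; decide)) <;> clear hjk hj <;>
      (simp [logCoord, logMatrix, ham_X_X, ham_ofNat, Derivation.leibniz_pow, genBracket,
        lowerBracket]
       try ring)

variable [CharZero K]

theorem ham_self (f : Alg K) : ham K f f = 0 := self_eq_neg.mp (bracket_skew K f f)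

theorem ham_logCoord (j k : Fin 4) : ham K (logCoord K j) (logCoord K k) =
    logMatrix j k * logCoord K j * logCoord K k := by
  rcases lt_trichotomy j k with h | rfl | h
  · exact ham_logCoord_of_lt h
  · have h0 : logMatrix j j = 0 := self_eq_neg.mp (logMatrix_skew j j)
    rw [ham_self, h0, Int.cast_zero, zero_mul, zero_mul]
  · rw [ham_apply, bracket_skew, ← ham_apply, ham_logCoord_of_lt h, logMatrix_skew j k]
    push_cast
    ring

theorem ham_X_casimir (i : Fin 6) (j : Fin 2) : ham K (X i) (casimir K j) = 0 := by
  fin_cases j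
  · have h : ham K (X i) (2 * Ω₁ K) = 0 := by
      rw [two_mul_Ω₁]
      fin_cases i <;>
        (simp [ham_X_X, ham_ofNat, Derivation.leibniz_pow, genBracket, lowerBracket]
         try ring)
    rw [Derivation.leibniz, ham_ofNat, smul_zero, add_zero, smul_eq_mul] at h
    exact (mul_eq_zero.mp h).resolve_left two_ne_zero
  · have h : ham K (X i) (6 * Ω₂ K) = 0 := by
      rw [six_mul_Ω₂]
      fin_cases i <;>
        (simp [ham_X_X, ham_ofNat, Derivation.leibniz_pow, genBracket, lowerBracket]
         try ring)
    rw [Derivation.leibniz, ham_ofNat, smul_zero, add_zero, smul_eq_mul] at h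
    exact (mul_eq_zero.mp h).resolve_left (by norm_num)

theorem bracket_casimir (a : Alg K) (j : Fin 2) : bracket K a (casimir K j) = 0 := by
  have h : ham K (casimir K j) = 0 := derivation_ext fun i => by
    rw [ham_X_right, ham_X_casimir, neg_zero, Derivation.zero_apply]
  rw [bracket_skew, ← ham_apply, h, Derivation.zero_apply, neg_zero]

theorem bracket_casimirHom (a : Alg K) (r : MvPolynomial (Fin 2) K) :
    bracket K a (casimirHom K r) = 0 := by
  induction r using MvPolynomial.induction_on with
  | C c => rw [casimirHom, algHom_C, ← ham_apply, Derivation.map_algebraMap]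
  | add p q hp hq => rw [map_add, map_add, hp, hq, add_zero]
  | mul_X p i hp =>
    rw [map_mul, bracket_leibniz, hp, casimirHom, aeval_X, bracket_casimir, zero_mul, mul_zero,
      add_zero]

/-- The Hamiltonian derivations of the log-canonical family act by Euler derivations. -/
theorem ham_logHom (j : Fin 4) (f : MvPolynomial (Fin 4) (MvPolynomial (Fin 2) K)) :
    ham K (logCoord K j) (logHom K f) =
      logCoord K j * logHom K (∑ k, Int.cast (logMatrix j k) * (X k * pderiv k f)) := by
  classical
  induction f using MvPolynomial.induction_on with
  | C r => simp [logHom_C, ham_apply, bracket_casimirHom]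
  | add p q hp hq =>
    simp only [map_add, hp, hq, mul_add, Finset.sum_add_distrib]
  | mul_X p i hp =>
    have hsum : ∑ k, Int.cast (logMatrix j k) *
        (X k * pderiv k (p * X i)) =
        (∑ k, Int.cast (logMatrix j k) *
          (X k * pderiv k p)) * X i + Int.cast (logMatrix j i) * X i * p := by
      have hk : ∀ k, Int.cast (logMatrix j k) *
          (X k * pderiv k (p * X i)) = Int.cast (logMatrix j k) * (X k * pderiv k p) * X i +
            if k = i then Int.cast (logMatrix j i) * X i * p else 0 := by
        intro k
        rw [Derivation.leibniz, pderiv_X, Pi.single_apply, smul_eq_mul, smul_eq_mul]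
        split_ifs with h1 h2 h2
        · subst h1; ring
        · exact (h2 h1.symm).elim
        · exact (h1 h2.symm).elim
        · ring
      rw [Finset.sum_congr rfl fun k _ => hk k, Finset.sum_add_distrib, ← Finset.sum_mul,
        Finset.sum_ite_eq' Finset.univ i, if_pos (Finset.mem_univ i)]
    rw [hsum, map_mul, Derivation.leibniz, hp, logHom_X, ham_logCoord, map_add, map_mul, map_mul,
      map_mul, logHom_X, logHom_intCast, smul_eq_mul, smul_eq_mul]
    ring

/-- The polynomial algebra is, up to inverting the log-canonical family, generated by it over the
Casimirs. -/
theorem exists_pow_mul_mem_range (f : Alg K) :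
    ∃ n : ℕ, (∏ j, logCoord K j) ^ n * f ∈ (logHom K).range := by
  set s := ∏ j, logCoord K j with hs
  have hcoord : ∀ j, logCoord K j ∈ (logHom K).range := fun j => ⟨X j, logHom_X j⟩
  have hcas : ∀ j, casimir K j ∈ (logHom K).range := fun j =>
    ⟨C (X j), by rw [logHom_C, casimirHom, aeval_X]⟩
  have hC : ∀ c : K, (C c : Alg K) ∈ (logHom K).range := fun c =>
    ⟨C (C c), by rw [logHom_C, casimirHom, algHom_C, algebraMap_eq]⟩
  have hsmem : s ∈ (logHom K).range := Subring.prod_mem _ fun j _ => hcoord j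
  let T : Set (Alg K) := {f | ∃ n : ℕ, s ^ n * f ∈ (logHom K).range}
  have hTr : ∀ {f}, f ∈ (logHom K).range → f ∈ T := fun hf => ⟨0, by simpa using hf⟩
  have hTC : ∀ c : K, (C c : Alg K) ∈ T := fun c => hTr (hC c)
  have hTn : ∀ n : ℕ, (n : Alg K) ∈ T := fun n => hTr (natCast_mem _ n)
  have hTadd : ∀ {f g}, f ∈ T → g ∈ T → f + g ∈ T := by
    rintro f g ⟨n, hn⟩ ⟨m, hm⟩
    refine ⟨n + m, ?_⟩
    have : s ^ (n + m) * (f + g) = s ^ m * (s ^ n * f) + s ^ n * (s ^ m * g) := by ring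
    rw [this]
    exact add_mem (mul_mem (pow_mem hsmem m) hn) (mul_mem (pow_mem hsmem n) hm)
  have hTmul : ∀ {f g}, f ∈ T → g ∈ T → f * g ∈ T := by
    rintro f g ⟨n, hn⟩ ⟨m, hm⟩
    refine ⟨n + m, ?_⟩
    have : s ^ (n + m) * (f * g) = (s ^ n * f) * (s ^ m * g) := by ring
    rw [this]
    exact mul_mem hn hm
  have hTpow : ∀ {f} (n : ℕ), f ∈ T → f ^ n ∈ T := fun {f} n hf => by
    induction n with
    | zero => simpa using hTC 1
    | succ n ih => rw [pow_succ]; exact hTmul ih hf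
  have hTsub : ∀ {f g}, f ∈ T → g ∈ T → f - g ∈ T := fun {f g} hf hg => by
    have : f - g = f + C (-1) * g := by rw [C_neg, C_1]; ring
    rw [this]
    exact hTadd hf (hTmul (hTC _) hg)
  have hTdiv : ∀ (j : Fin 4) {f}, logCoord K j * f ∈ T → f ∈ T := by
    rintro j f ⟨n, hn⟩
    refine ⟨n + 1, ?_⟩
    have : s ^ (n + 1) * f =
        (∏ k ∈ Finset.univ.erase j, logCoord K k) * (s ^ n * (logCoord K j * f)) := by
      rw [pow_succ]
      nth_rewrite 2 [hs]
      rw [← Finset.mul_prod_erase _ _ (Finset.mem_univ j)]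
      ring
    rw [this]
    exact mul_mem (Subring.prod_mem _ fun k _ => hcoord k) hn
  have hTscale : ∀ (n : ℕ) {f}, n ≠ 0 → (n : Alg K) * f ∈ T → f ∈ T := fun n f hn hf => by
    have : f = C (n : K)⁻¹ * (Nat.cast n * f) := by
      rw [← map_natCast (C : K →+* Alg K), ← mul_assoc, ← C_mul,
        inv_mul_cancel₀ (Nat.cast_ne_zero.mpr hn), C_1, one_mul]
    rw [this]
    exact hTmul (hTC _) hf
  have hx6 : (X 5 : Alg K) ∈ T := hTr (hcoord 0)
  have hx5 : (X 4 : Alg K) ∈ T := hTr (hcoord 1)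
  have hv : logCoord K 2 ∈ T := hTr (hcoord 2)
  have hu : logCoord K 3 ∈ T := hTr (hcoord 3)
  have hx4 : (X 3 : Alg K) ∈ T := by
    refine hTscale 3 three_ne_zero (hTdiv 0 ?_)
    have : logCoord K 0 * (((3 : ℕ) : Alg K) * X 3) = logCoord K 2 + ((2 : ℕ) : Alg K) * X 4 ^ 3 := by
      simp [logCoord]; ring
    rw [this]
    exact hTadd hv (hTmul (hTn 2) (hTpow 3 hx5))
  have hx3 : (X 2 : Alg K) ∈ T := by
    refine hTscale 2 two_ne_zero (hTdiv 1 ?_)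
    have : logCoord K 1 * (((2 : ℕ) : Alg K) * X 2) = logCoord K 3 + ((3 : ℕ) : Alg K) * X 3 := by
      simp [logCoord]; ring
    rw [this]
    exact hTadd hu (hTmul (hTn 3) hx4)
  -- X₂ is solved from 6Ω₂, where its coefficient is 2v; X₁ is then solved from 2Ω₁, where its
  -- coefficient is u.
  have hx2 : (X 1 : Alg K) ∈ T := by
    refine hTscale 2 two_ne_zero (hTdiv 2 ?_)
    have : logCoord K 2 * (((2 : ℕ) : Alg K) * X 1) = ((6 : ℕ) : Alg K) * casimir K 1 + ((4 : ℕ) : Alg K) * X 2 ^ 3 * X 5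
        - ((12 : ℕ) : Alg K) * X 2 ^ 2 * X 4 ^ 2 + ((18 : ℕ) : Alg K) * X 2 * X 3 * X 4 - ((9 : ℕ) : Alg K) * X 3 ^ 2 := by
      have h := six_mul_Ω₂ (K := K)
      simp [logCoord, casimir]
      linear_combination -h
    rw [this]
    exact hTsub (hTadd (hTsub (hTadd (hTmul (hTn 6) (hTr (hcas 1)))
      (hTmul (hTmul (hTn 4) (hTpow 3 hx3)) hx6))
      (hTmul (hTmul (hTn 12) (hTpow 2 hx3)) (hTpow 2 hx5)))
      (hTmul (hTmul (hTmul (hTn 18) hx3) hx4) hx5)) (hTmul (hTn 9) (hTpow 2 hx4))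
  have hx1 : (X 0 : Alg K) ∈ T := by
    refine hTdiv 3 ?_
    have : logCoord K 3 * X 0 = ((2 : ℕ) : Alg K) * casimir K 0 + X 1 * X 4 - X 2 ^ 2 := by
      have h := two_mul_Ω₁ (K := K)
      simp [logCoord, casimir]
      linear_combination -h
    rw [this]
    exact hTsub (hTadd (hTmul (hTn 2) (hTr (hcas 0))) (hTmul hx2 hx5)) (hTpow 2 hx3)
  change f ∈ T
  induction f using MvPolynomial.induction_on with
  | C c => exact hTC c
  | add p q hp hq => exact hTadd hp hq
  | mul_X p i hp =>
    refine hTmul hp ?_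
    fin_cases i
    exacts [hx1, hx2, hx3, hx4, hx5, hx6]

/-- The preimage of a Poisson prime avoiding the log-canonical family is stable under the Euler
derivations. -/
theorem logHom_euler_mem {P : Ideal (Alg K)} (hP : P.IsPrime) (hB : (poisson K).IsPoissonIdeal P)
    (hx : ∀ j, logCoord K j ∉ P) (i : Fin 4)
    {f : MvPolynomial (Fin 4) (MvPolynomial (Fin 2) K)} (hf : logHom K f ∈ P) :
    logHom K (X i * pderiv i f) ∈ P := by
  have h : ∀ j, ∑ k, Int.cast (logMatrix j k) * logHom K (X k * pderiv k f) ∈ P := fun j => by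
    have h1 : ham K (logCoord K j) (logHom K f) ∈ P := hB _ _ hf
    rw [ham_logHom] at h1
    simpa only [map_sum, map_mul, map_intCast] using (hP.mem_or_mem h1).resolve_left (hx j)
  have hc : ∀ (n : ℕ) {g : Alg K}, n ≠ 0 → (n : Alg K) * g ∈ P → g ∈ P := fun n g hn hg => by
    rw [← map_natCast (C : K →+* Alg K)] at hg
    exact (P.unit_mul_mem_iff_mem
      ((isUnit_iff_ne_zero.mpr (Nat.cast_ne_zero.mpr hn)).map C)).mp hg
  set e : Fin 4 → Alg K := fun k => logHom K (X k * pderiv k f) with he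
  have h0 := h 0
  have h1 := h 1
  have h2 := h 2
  have h3 := h 3
  simp only [Fin.sum_univ_four, logMatrix] at h0 h1 h2 h3
  -- The four relations are inverted by hand: `logMatrix` has Pfaffian 6, so only 2 and 3 need to be
  -- divided out.
  have e3 : e 3 ∈ P := by
    refine hc 2 two_ne_zero ?_
    convert P.sub_mem h1 h2 using 1
    simp [he]
    ring
  have e0 : e 0 ∈ P := by
    refine hc 3 three_ne_zero ?_
    convert P.add_mem h2 (P.mul_mem_left 3 e3) using 1
    simp [he]
  have e1 : e 1 ∈ P := by
    refine hc 2 two_ne_zero ?_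
    convert P.sub_mem (P.mul_mem_left 3 e0) (P.add_mem (P.add_mem h0 h3) (P.mul_mem_left 3 e3))
      using 1
    simp [he]
    ring
  have e2 : e 2 ∈ P := by
    refine hc 3 three_ne_zero ?_
    convert P.sub_mem h3 (P.add_mem (P.mul_mem_left 3 e0) e1) using 1
    simp [he]
  fin_cases i
  exacts [e0, e1, e2, e3]

/-- A Poisson prime avoiding the log-canonical family is contained in any prime ideal avoiding
it that contains all the Casimirs of `P`. -/
theorem le_of_casimir_le {P I : Ideal (Alg K)} (hP : P.IsPrime)
    (hB : (poisson K).IsPoissonIdeal P) (hx : ∀ j, logCoord K j ∉ P) (hI : I.IsPrime)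
    (hxI : ∀ j, logCoord K j ∉ I) (h : ∀ r, casimirHom K r ∈ P → casimirHom K r ∈ I) : P ≤ I := by
  intro f hf
  obtain ⟨n, g, hg⟩ := exists_pow_mul_mem_range f
  have hmon : ∀ m c, logHom K (monomial m c) = casimirHom K c * ∏ j, logCoord K j ^ m j :=
    fun m c => by
      rw [monomial_eq, map_mul, logHom_C, Finsupp.prod_fintype _ _ (by simp), map_prod]
      simp only [map_pow, logHom_X]
  have hgP : logHom K g ∈ P := hg ▸ P.mul_mem_left _ hf
  have hgI : logHom K g ∈ I := by
    rw [g.as_sum, map_sum]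
    refine I.sum_mem fun m _ => ?_
    -- Euler stability isolates each monomial term, and since P avoids the log-canonical elements
    -- its Casimir coefficient must already lie in P.
    have hm : logHom K (monomial m (coeff m g)) ∈ P :=
      monomial_coeff_mem_of_euler
        (Submodule.restrictScalars (MvPolynomial (Fin 2) K) (P.comap (logHom K)))
        (fun i f hf => logHom_euler_mem hP hB hx i hf) hgP m
    rw [hmon] at hm ⊢
    refine I.mul_mem_right _ (h _ ((hP.mem_or_mem hm).resolve_right fun hprod => ?_))
    obtain ⟨j, _, hj⟩ := hP.prod_mem_iff.mp hprod
    exact hx j (hP.mem_of_pow_mem _ hj)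
  rw [hg] at hgI
  refine (hI.mem_or_mem hgI).resolve_left fun hpow => ?_
  obtain ⟨j, _, hj⟩ := hI.prod_mem_iff.mp (hI.mem_of_pow_mem _ hpow)
  exact hxI j hj

end G2

/-! ### The torus action, semi-invariants and cores -/

namespace PoissonBracket

variable {K A H : Type*} [CommRing K] [CommRing A] [Algebra K A] [Group H] {ρ : H →* (A ≃ₐ[K] A)}

theorem core_le (P : Ideal A) : core ρ P ≤ P := by
  refine (iInf_le _ 1).trans_eq ?_
  rw [map_one]
  exact Ideal.map_id P

theorem mem_core {P : Ideal A} {x : A} : x ∈ core ρ P ↔ ∀ h, x ∈ P.map (ρ h) := by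
  rw [core, Submodule.mem_iInf]

/-- A semi-invariant element of `P` lies in the core of `P`. -/
theorem mem_core_of_semiinvariant {P : Ideal A} {x : A} (hx : x ∈ P)
    (h : ∀ g, ∃ c : K, x = c • ρ g x) : x ∈ core ρ P := by
  refine mem_core.mpr fun g => ?_
  obtain ⟨c, hc⟩ := h g
  rw [hc]
  exact Submodule.smul_of_tower_mem _ c (Ideal.mem_map_of_mem (ρ g) hx)

end PoissonBracket

namespace G2

open PoissonBracket

variable {K : Type*} [Field K]

theorem torusAction_apply (h : Kˣ × Kˣ) (f : Alg K) : torusAction K h f = scale K h f := rfl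

theorem eval_torusAction (x : Fin 6 → K) (h : Kˣ × Kˣ) (f : Alg K) :
    eval x (torusAction K h f) = eval (fun i => weight K h i * x i) f := by
  rw [torusAction_apply]
  induction f using MvPolynomial.induction_on with
  | C c => simp [scale]
  | add p q hp hq => simp only [map_add, hp, hq]
  | mul_X p i hp =>
    rw [map_mul, map_mul, hp, map_mul]
    simp [scale]

/-- The character by which the torus acts on `Ω₁`, `Ω₂`. -/
def casimirWeight (h : Kˣ × Kˣ) : Fin 2 → Kˣ := ![h.1 ^ 4 * h.2 ^ 2, h.1 ^ 6 * h.2 ^ 4]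

/-- The character by which the torus acts on the log-canonical family. -/
def logWeight (h : Kˣ × Kˣ) : Fin 4 → Kˣ :=
  ![h.2, h.1 * h.2, h.1 ^ 3 * h.2 ^ 3, h.1 ^ 3 * h.2 ^ 2]

theorem scale_casimir (h : Kˣ × Kˣ) (i : Fin 2) :
    scale K h (casimir K i) = C (casimirWeight h i : K) * casimir K i := by
  fin_cases i
  · change scale K h (Ω₁ K) = C ((h.1 ^ 4 * h.2 ^ 2 : Kˣ) : K) * Ω₁ K
    simp only [scale, Ω₁, map_add, map_sub, map_mul, map_pow, aeval_X, algHom_C, algebraMap_eq]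
    simp [weight]
    ring
  · change scale K h (Ω₂ K) = C ((h.1 ^ 6 * h.2 ^ 4 : Kˣ) : K) * Ω₂ K
    simp only [scale, Ω₂, map_add, map_sub, map_mul, map_pow, aeval_X, algHom_C, algebraMap_eq,
      map_ofNat]
    simp [weight]
    ring

theorem scale_logCoord (h : Kˣ × Kˣ) (i : Fin 4) :
    scale K h (logCoord K i) = C (logWeight h i : K) * logCoord K i := by
  fin_cases i <;>
  · simp [scale, logCoord, logWeight, weight, map_ofNat]
    try ring

theorem eq_smul_torusAction {x : Alg K} {h : Kˣ × Kˣ} {c : Kˣ}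
    (hx : scale K h x = C (c : K) * x) : ∃ c : K, x = c • torusAction K h x := by
  refine ⟨(c : K)⁻¹, ?_⟩
  rw [torusAction_apply, hx, smul_eq_C_mul, ← mul_assoc, ← C_mul, inv_mul_cancel₀ c.ne_zero, C_1,
    one_mul]

theorem casimir_mem_core {P : Ideal (Alg K)} {i : Fin 2} (h : casimir K i ∈ P) :
    casimir K i ∈ core (torusAction K) P :=
  mem_core_of_semiinvariant h fun g => eq_smul_torusAction (scale_casimir g i)

theorem logCoord_mem_core {P : Ideal (Alg K)} {i : Fin 4} (h : logCoord K i ∈ P) :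
    logCoord K i ∈ core (torusAction K) P :=
  mem_core_of_semiinvariant h fun g => eq_smul_torusAction (scale_logCoord g i)

theorem casimirWeight_surjective [IsAlgClosed K] (i : Fin 2) (c : Kˣ) :
    ∃ h : Kˣ × Kˣ, casimirWeight h i = c := by
  have key : ∀ n : ℕ, 0 < n → ∃ z : Kˣ, z ^ n = c := fun n hn => by
    obtain ⟨z, hz⟩ := IsAlgClosed.exists_pow_nat_eq (c : K) hn
    have hz0 : z ≠ 0 := by
      rintro rfl
      rw [zero_pow hn.ne'] at hz
      exact c.ne_zero hz.symm
    exact ⟨Units.mk0 z hz0, Units.ext (by simpa using hz)⟩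
  fin_cases i
  · obtain ⟨z, hz⟩ := key 2 (by norm_num)
    exact ⟨(1, z), by simpa [casimirWeight] using hz⟩
  · obtain ⟨z, hz⟩ := key 4 (by norm_num)
    exact ⟨(1, z), by simpa [casimirWeight] using hz⟩

/-- A Casimir is congruent to its value at `z` modulo `Ω₁ - z₁`, `Ω₂ - z₂`. -/
theorem casimirHom_sub_eval_mem {I : Ideal (Alg K)} {z : Fin 2 → K}
    (hI : ∀ j, casimir K j - C (z j) ∈ I) (r : MvPolynomial (Fin 2) K) :
    casimirHom K r - C (eval z r) ∈ I := by
  rw [← Ideal.Quotient.eq]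
  induction r using MvPolynomial.induction_on with
  | C c => rw [casimirHom, algHom_C, eval_C, algebraMap_eq]
  | add p q hp hq => rw [map_add, map_add, map_add, hp, hq, ← map_add, ← map_add, ← map_add]
  | mul_X p i hp =>
    rw [map_mul, map_mul, map_mul, eval_X, C_mul, map_mul, hp]
    congr 1
    rw [casimirHom, aeval_X]
    exact Ideal.Quotient.eq.mpr (hI i)

/-- Modulo `Ωᵢ`, a Casimir is a univariate polynomial in the other `Ωₖ`. -/
theorem casimirHom_sub_aeval_mem {I : Ideal (Alg K)} {i k : Fin 2} (hik : k ≠ i)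
    (hI : casimir K i ∈ I) (r : MvPolynomial (Fin 2) K) :
    casimirHom K r - Polynomial.aeval (casimir K k)
      (aeval (Pi.single k Polynomial.X : Fin 2 → Polynomial K) r) ∈ I := by
  rw [← Ideal.Quotient.eq]
  induction r using MvPolynomial.induction_on with
  | C c => simp [casimirHom]
  | add p q hp hq => simp only [map_add, hp, hq]
  | mul_X p j hp =>
    simp only [map_mul, hp]
    congr 1
    rw [casimirHom, aeval_X, aeval_X]
    by_cases hj : j = k
    · subst hj
      rw [Pi.single_eq_same, Polynomial.aeval_X]
    · obtain rfl : j = i := by omega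
      rw [Pi.single_eq_of_ne hj, map_zero, map_zero]
      exact Ideal.Quotient.eq_zero_iff_mem.mpr hI

theorem isPoissonIdeal_of_casimir [CharZero K] {S : Set (Alg K)}
    (hS : ∀ z ∈ S, ∃ j, ∃ c : K, z = casimir K j - C c) :
    (poisson K).IsPoissonIdeal (Ideal.span S) := by
  refine isPoissonIdeal_span fun z hz a => ?_
  obtain ⟨j, c, rfl⟩ := hS z hz
  change bracket K a _ = 0
  rw [map_sub, bracket_casimir, ← ham_apply, ← algebraMap_eq, Derivation.map_algebraMap, sub_zero]

/-- A point at which `Ω₁ = α`, `Ω₂ = β` and the log-canonical family does not vanish. -/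
theorem exists_point [CharZero K] (z : Fin 2 → K) : ∃ x : Fin 6 → K,
    (∀ j, eval x (casimir K j) = z j) ∧ ∀ j, eval x (logCoord K j) ≠ 0 := by
  -- With X₃, …, X₆ set to 0, 1, 1, 2 the log-canonical family takes the values 2, 1, 4, -3, while
  -- 6Ω₂ = 8X₂ + 9 and 2Ω₁ = -3X₁ - X₂ can be solved for X₂, then X₁.
  refine ⟨![-(2 * z 0 + (6 * z 1 - 9) / 8) / 3, (6 * z 1 - 9) / 8, 0, 1, 1, 2], ?_, ?_⟩
  · intro j
    fin_cases j
    · simp [casimir, Ω₁]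
      field_simp
      ring
    · simp [casimir, Ω₂]
      field_simp
      ring
  · intro j
    fin_cases j <;> simp [logCoord]
    norm_num

theorem eval_eq_zero_of_mem_span {x : Fin 6 → K} {S : Set (Alg K)} (hS : ∀ f ∈ S, eval x f = 0)
    {f : Alg K} (hf : f ∈ Ideal.span S) : eval x f = 0 := by
  have : Ideal.span S ≤ RingHom.ker (eval x) := Ideal.span_le.mpr hS
  exact this hf

/-! ### Determination of the strata -/

variable [CharZero K]

theorem logCoord_notMem {i k : Fin 2} (c : K) (hik : k ≠ i) (j : Fin 4) :
    logCoord K j ∉ Ideal.span {casimir K i, casimir K k - C c} := by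
  intro h
  obtain ⟨x, hx, hx'⟩ := exists_point (Pi.single k c : Fin 2 → K)
  refine hx' j (eval_eq_zero_of_mem_span ?_ h)
  rintro f (rfl | rfl)
  · rw [hx, Pi.single_eq_of_ne hik.symm]
  · rw [map_sub, hx, Pi.single_eq_same, eval_C, sub_self]

theorem logCoord_notMem_span_casimir (i : Fin 2) (j : Fin 4) :
    logCoord K j ∉ Ideal.span {casimir K i} := by
  intro h
  obtain ⟨k, hik⟩ := exists_ne i
  exact logCoord_notMem 0 hik j (Ideal.span_mono (by simp) h)

theorem casimir_notMem_span_casimir {i k : Fin 2} (hik : k ≠ i) :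
    casimir K k ∉ Ideal.span {casimir K i} := by
  intro h
  obtain ⟨x, hx, -⟩ := exists_point (Pi.single k 1 : Fin 2 → K)
  have h0 := eval_eq_zero_of_mem_span (x := x) (by
    rintro f rfl
    rw [hx, Pi.single_eq_of_ne hik.symm]) h
  rw [hx, Pi.single_eq_same] at h0
  exact one_ne_zero h0

theorem prime_casimir (i : Fin 2) : Prime (casimir K i) := by
  fin_cases i
  exacts [prime_Ω₁, prime_Ω₂]

theorem isPrime_span_casimir (i : Fin 2) : (Ideal.span {casimir K i}).IsPrime :=
  (Ideal.span_singleton_prime (prime_casimir i).ne_zero).mpr (prime_casimir i)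

theorem isPrime_span_casimir_pair {i k : Fin 2} (hik : k ≠ i) {c : K} (hc : c ≠ 0) :
    (Ideal.span {casimir K i, casimir K k - C c}).IsPrime := by
  fin_cases i <;> fin_cases k <;> (try exact (hik rfl).elim)
  · simpa [casimir] using isPrime_span_pair (K := K) (Or.inl ⟨rfl, hc⟩)
  · rw [Set.pair_comm]
    simpa [casimir] using isPrime_span_pair (K := K) (Or.inr ⟨hc, rfl⟩)

theorem mem_stratum_span_casimir (i : Fin 2) : Ideal.span {casimir K i} ∈
    (poisson K).stratum (torusAction K) (Ideal.span {casimir K i}) := by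
  refine ⟨isPoissonPrime_of_isPrime (isPrime_span_casimir i)
    (isPoissonIdeal_of_casimir ?_), le_antisymm (core_le _) ?_⟩
  · rintro z rfl
    exact ⟨i, 0, by rw [C_0, sub_zero]⟩
  · rw [Ideal.span_singleton_le_iff_mem]
    exact casimir_mem_core (Ideal.subset_span rfl)

variable [IsAlgClosed K]

theorem mem_stratum_span_casimir_pair {i k : Fin 2} (hik : k ≠ i) {c : K} (hc : c ≠ 0) :
    Ideal.span {casimir K i, casimir K k - C c} ∈
      (poisson K).stratum (torusAction K) (Ideal.span {casimir K i}) := by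
  refine ⟨isPoissonPrime_of_isPrime (isPrime_span_casimir_pair hik hc)
    (isPoissonIdeal_of_casimir ?_), le_antisymm (fun f hf => ?_) ?_⟩
  · rintro z (rfl | rfl)
    · exact ⟨i, 0, by rw [C_0, sub_zero]⟩
    · exact ⟨k, c, rfl⟩
  · have := isPrime_span_casimir (K := K) i
    -- Multiplying by Ωₖ removes the points with Ωₖ = 0, which no torus element moves to the level
    -- Ωₖ = c. It then suffices that f Ωₖ vanishes on {Ωᵢ = 0}.
    refine (this.mem_or_mem (x := f) (y := casimir K k) ?_).resolve_right
      (casimir_notMem_span_casimir hik)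
    rw [← IsPrime.vanishingIdeal_zeroLocus (k := K) (K := K) (Ideal.span {casimir K i})]
    intro x hx
    have hxi : eval x (casimir K i) = 0 := hx _ (Ideal.subset_span rfl)
    change eval x (f * casimir K k) = 0
    rw [map_mul]
    by_cases hxk : eval x (casimir K k) = 0
    · rw [hxk, mul_zero]
    -- This h moves x to a zero of the ideal, and f, lying in the h-translate of the ideal,
    -- therefore vanishes at x.
    · obtain ⟨h, hh⟩ := casimirWeight_surjective k (Units.mk0 _ hc / Units.mk0 _ hxk)
      have hev : ∀ j, eval (fun l => weight K h l * x l) (casimir K j) =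
          casimirWeight h j * eval x (casimir K j) := fun j => by
        rw [← eval_torusAction, torusAction_apply, scale_casimir, map_mul, eval_C]
      obtain ⟨g, hg, rfl⟩ := (Ideal.mem_map_of_equiv (torusAction K h) f).mp (mem_core.mp hf h)
      rw [eval_torusAction, eval_eq_zero_of_mem_span ?_ hg, zero_mul]
      rintro p (rfl | rfl)
      · rw [hev, hxi, mul_zero]
      · rw [map_sub, hev, hh, eval_C, Units.val_div_eq_div_val, Units.val_mk0, Units.val_mk0,
          div_mul_cancel₀ _ hxk, sub_self]
  · rw [Ideal.span_singleton_le_iff_mem]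
    exact casimir_mem_core (Ideal.subset_span (by simp))

theorem eq_of_mem_stratum {i k : Fin 2} (hik : k ≠ i) {P : Ideal (Alg K)}
    (hP : P ∈ (poisson K).stratum (torusAction K) (Ideal.span {casimir K i})) :
    P = Ideal.span {casimir K i} ∨
      ∃ c : K, c ≠ 0 ∧ P = Ideal.span {casimir K i, casimir K k - C c} := by
  obtain ⟨hPP, hcore⟩ := hP
  have hprime := hPP.isPrime
  have hle : Ideal.span {casimir K i} ≤ P := hcore ▸ core_le P
  have hi : casimir K i ∈ P := hle (Ideal.subset_span rfl)
  have hk : casimir K k ∉ P := fun h =>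
    casimir_notMem_span_casimir hik (hcore ▸ casimir_mem_core h)
  have hlog : ∀ j, logCoord K j ∉ P := fun j h =>
    logCoord_notMem_span_casimir i j (hcore ▸ logCoord_mem_core h)
  by_cases hr : ∀ r, casimirHom K r ∈ P → casimirHom K r ∈ Ideal.span {casimir K i}
  · exact Or.inl (le_antisymm (le_of_casimir_le hprime hPP.2.1 hlog (isPrime_span_casimir i)
      (logCoord_notMem_span_casimir i) hr) hle)
  · right
    push Not at hr
    obtain ⟨r, hrP, hri⟩ := hr
    -- The image of r under Ωᵢ ↦ 0, Ωₖ ↦ T. It is nonzero since r does not map into ⟨Ωᵢ⟩; it splits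
    -- over K, so the prime P contains some Ωₖ - c.
    set p : Polynomial K := aeval (Pi.single k Polynomial.X : Fin 2 → Polynomial K) r with hp
    have hmem := casimirHom_sub_aeval_mem hik (Ideal.mem_span_singleton_self (casimir K i)) r
    have hpP : Polynomial.aeval (casimir K k) p ∈ P := (P.sub_mem_iff_right hrP).mp (hle hmem)
    have hp0 : p ≠ 0 := fun h0 => by
      rw [← hp, h0, map_zero, sub_zero] at hmem
      exact hri hmem
    obtain ⟨c, hcP⟩ : ∃ c : K, casimir K k - C c ∈ P := by
      rw [(IsAlgClosed.splits p).eq_prod_roots, map_mul, Polynomial.aeval_C, map_multiset_prod,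
        Multiset.map_map] at hpP
      have hunit : IsUnit (algebraMap K (Alg K) p.leadingCoeff) :=
        (isUnit_iff_ne_zero.mpr (Polynomial.leadingCoeff_ne_zero.mpr hp0)).map _
      rw [P.unit_mul_mem_iff_mem hunit, hprime.multiset_prod_mem_iff_exists_mem] at hpP
      obtain ⟨q, hq, hqP⟩ := hpP
      obtain ⟨c, -, rfl⟩ := Multiset.mem_map.mp hq
      exact ⟨c, by simpa using hqP⟩
    have hc : c ≠ 0 := by
      rintro rfl
      rw [C_0, sub_zero] at hcP
      exact hk hcP
    refine ⟨c, hc, le_antisymm ?_ ?_⟩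
    · refine le_of_casimir_le hprime hPP.2.1 hlog (isPrime_span_casimir_pair hik hc)
        (logCoord_notMem c hik) fun s hs => ?_
      have hgen : ∀ j, casimir K j - C ((Pi.single k c : Fin 2 → K) j) ∈
          ({casimir K i, casimir K k - C c} : Set (Alg K)) := fun j => by
        by_cases hj : j = k
        · subst hj
          simp
        · obtain rfl : j = i := by omega
          simp [Pi.single_eq_of_ne hj]
      have hgenP : ({casimir K i, casimir K k - C c} : Set (Alg K)) ⊆ P := by
        rintro f (rfl | rfl)
        exacts [hi, hcP]
      have h1 := casimirHom_sub_eval_mem (fun j => Ideal.subset_span (hgen j)) s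
      have h2 : C (eval (Pi.single k c : Fin 2 → K) s) ∈ P :=
        (P.sub_mem_iff_right hs).mp (Ideal.span_le.mpr hgenP h1)
      -- A Casimir in P is congruent modulo ⟨Ωᵢ, Ωₖ - c⟩ ⊆ P to a scalar, and a proper ideal
      -- contains no nonzero scalar.
      have h3 : eval (Pi.single k c : Fin 2 → K) s = 0 := by
        by_contra hne
        exact hprime.ne_top (P.eq_top_of_isUnit_mem h2 ((isUnit_iff_ne_zero.mpr hne).map C))
      rwa [h3, C_0, sub_zero] at h1
    · rw [Ideal.span_le]
      rintro f (rfl | rfl)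
      exacts [hi, hcP]

/-- The stratum of the prime ideal generated by one of `Ω₁`, `Ω₂`. -/
theorem stratum_span_casimir {i k : Fin 2} (hik : k ≠ i) :
    (poisson K).stratum (torusAction K) (Ideal.span {casimir K i}) =
      {Ideal.span {casimir K i}} ∪
        {P | ∃ c : K, c ≠ 0 ∧ P = Ideal.span {casimir K i, casimir K k - C c}} := by
  ext P
  refine ⟨eq_of_mem_stratum hik, ?_⟩
  rintro (rfl | ⟨c, hc, rfl⟩)
  exacts [mem_stratum_span_casimir i, mem_stratum_span_casimir_pair hik hc]

end G2

theorem mainTheorem6 (K : Type*) [Field K] [IsAlgClosed K] [CharZero K] :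
    (G2.poisson K).stratum (G2.torusAction K) (Ideal.span {G2.Ω₁ K}) =
        {Ideal.span {G2.Ω₁ K}} ∪
          {P | ∃ β : K, β ≠ 0 ∧ P = Ideal.span {G2.Ω₁ K, G2.Ω₂ K - C β}} ∧
      (G2.poisson K).stratum (G2.torusAction K) (Ideal.span {G2.Ω₂ K}) =
        {Ideal.span {G2.Ω₂ K}} ∪
          {P | ∃ α : K, α ≠ 0 ∧ P = Ideal.span {G2.Ω₁ K - C α, G2.Ω₂ K}} := by
  refine ⟨G2.stratum_span_casimir (i := 0) (k := 1) (by decide), ?_⟩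
  simp only [Set.pair_comm _ (G2.Ω₂ K)]
  exact G2.stratum_span_casimir (i := 1) (k := 0) (by decide)
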